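/- For an integer $d\ge 2$ let $V_d=\pi^{d/2}/\Gamma(d/2+1)$ be the volume of the $d$-dimensional Euclidean unit ball, let $F(z)=\frac1z\left(\frac{\ln(1+z)}{z}-\frac1{1+z}\right)$ for $z>0$, and let $z(\theta)=\max(2\cos\theta,0)$ for $\theta\in[0,\pi]$. Let $$\frac{\mathcal L(z,\theta)}{V_d}=z^d-\frac{V_{d-1}}{V_d}\left(\int_{\frac{1-z\cos\theta}{\sqrt{(1-z\cos\theta)^2+(z\sin\theta)^2}}}^{1}(1-x^2)^{\frac{d-1}2}\,dx+z^d\int_{-1}^{\frac{\cos\theta-z}{\sqrt{(\cos\theta-z)^2+(\sin\theta)^2}}}(1-x^2)^{\frac{d-1}2}\,dx\right)$$ (so $\mathcal L(z,\theta)$ is the volume of a ball of radius $z$ minus a ball of radius $1$ whose centre is at distance $\sqrt{1+z^2-2z\cos\theta}$). Put $$T_+(d)=2\,\frac{(d-1)V_{d-1}}{dV_d}\int_0^1(1-z^2)^{\frac{d-3}2}\left(1-\frac{\ln(1+2^dz^d)}{2^dz^d}\right)dz,$$ $$T_-(d)=2\,\frac{(d-1)V_{d-1}}{dV_d}\int_0^\pi\sin(\theta)^{d-2}\int_{z(\theta)^d}^\infty\left(F\!\left(\frac{\mathcal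 L(u^{1/d},\theta)}{V_d}\right)-F(u)\right)du\,d\theta,$$ $$S_d=2\,\frac{(d-1)V_{d-1}}{V_d}\int_0^\pi\sin(\theta)^{d-2}\int_{z(\theta)}^\infty z^{d-1}F\!\left(\frac{\mathcal L(z,\theta)}{V_d}\right)dz\,d\theta$$ (the closed form of the asymptotic mean number of siblings in the $d$-dimensional nearest-neighbour tree). Theorem. For every $d\ge2$ these integrals converge, and $T_+(d)>0$ and $T_-(d)>0$. As $d\to\infty$, $$T_+(d)\sim\frac{2\sqrt{2\pi}}{3}\,\frac1{\sqrt d}\left(\frac{\sqrt3}{2}\right)^d\qquad\text{and}\qquad T_-(d)=O\!\left(\left(\frac{4\sqrt3}{9}\right)^d\right).$$ Hence $S_d\to2$ exponentially fast, at rate $\sqrt3/2$: $$2-S_d\sim\frac{2\sqrt{2\pi}}{3}\,\frac1{\sqrt d}\left(\frac{\sqrt3}{2}\right)^d.$$ -/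

import Mathlib

open Filter Asymptotics MeasureTheory Set

noncomputable section

namespace NNTree

/-- `V_d = π^{d/2} / Γ(d/2 + 1)`, the volume of the Euclidean unit ball in dimension `d`. -/
def V (d : ℕ) : ℝ := Real.pi ^ ((d : ℝ) / 2) / Real.Gamma ((d : ℝ) / 2 + 1)

/-- `F(z) = (1/z) (ln(1+z)/z - 1/(1+z))`, meant for `z > 0`. -/
def F (z : ℝ) : ℝ := 1 / z * (1 / z * Real.log (1 + z) - 1 / (1 + z))

/-- `z(θ) = (2 cos θ)_+`. -/
def zMin (θ : ℝ) : ℝ := max (2 * Real.cos θ) 0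

/-- The normalised volume `𝓛(z,θ) / V_d` of the ball of radius `z` deprived of the ball of radius
`1`, the distance between the centres being `√(1 + z² - 2 z cos θ)`. -/
def lune (d : ℕ) (z θ : ℝ) : ℝ :=
  z ^ d - V (d - 1) / V d *
    ((∫ x in ((1 - z * Real.cos θ) /
          √((1 - z * Real.cos θ) ^ 2 + (z * Real.sin θ) ^ 2))..(1 : ℝ),
        (1 - x ^ 2) ^ (((d : ℝ) - 1) / 2)) +
      z ^ d * ∫ x in (-1 : ℝ)..((Real.cos θ - z) /
          √((Real.cos θ - z) ^ 2 + Real.sin θ ^ 2)),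
        (1 - x ^ 2) ^ (((d : ℝ) - 1) / 2))

/-- The integrand of `T_+(d)`. -/
def plusIntegrand (d : ℕ) (z : ℝ) : ℝ :=
  (1 - z ^ 2) ^ (((d : ℝ) - 3) / 2) *
    (1 - Real.log (1 + 2 ^ d * z ^ d) / (2 ^ d * z ^ d))

/-- `T_+(d)`, for `d ≥ 2`. -/
def TPlus (d : ℕ) : ℝ :=
  2 * (((d : ℝ) - 1) * V (d - 1) / ((d : ℝ) * V d)) * ∫ z in (0 : ℝ)..1, plusIntegrand d z

/-- The integrand (in `u`) of the inner integral of `T_-(d)`. -/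
def minusIntegrand (d : ℕ) (θ u : ℝ) : ℝ :=
  F (lune d (u ^ (1 / (d : ℝ))) θ) - F u

/-- The integrand (in `θ`) of the outer integral of `T_-(d)`. -/
def minusOuter (d : ℕ) (θ : ℝ) : ℝ :=
  Real.sin θ ^ (d - 2) * ∫ u in Ioi (zMin θ ^ d), minusIntegrand d θ u

/-- `T_-(d)`, for `d ≥ 2`. -/
def TMinus (d : ℕ) : ℝ :=
  2 * (((d : ℝ) - 1) * V (d - 1) / ((d : ℝ) * V d)) * ∫ θ in (0 : ℝ)..Real.pi, minusOuter d θ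

/-- The integrand (in `z`) of the inner integral of `S_d`. -/
def sibIntegrand (d : ℕ) (θ z : ℝ) : ℝ := z ^ (d - 1) * F (lune d z θ)

/-- The integrand (in `θ`) of the outer integral of `S_d`. -/
def sibOuter (d : ℕ) (θ : ℝ) : ℝ :=
  Real.sin θ ^ (d - 2) * ∫ z in Ioi (zMin θ), sibIntegrand d θ z

/-- `S_d`, for `d ≥ 2`, in its closed integral form. -/
def S (d : ℕ) : ℝ :=
  2 * (((d : ℝ) - 1) * V (d - 1) / V d) * ∫ θ in (0 : ℝ)..Real.pi, sibOuter d θ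

end NNTree

end

namespace NNTree

/-! Everything rests on the exact identity `S_eq`, that `S d` is `2 - TPlus d + TMinus d`. In the
variable `u = z ^ d`, split `F(lune) = F(u) + (F(lune) - F(u))`. Since `F` is the derivative of
`-log(1+u)/u`, the first term integrates to `logRatio (zMin θ ^ d)`. Writing this as `1 - (1 -
logRatio)`, the constant gives exactly `2`, because `angConst d` normalises `sin θ ^ (d - 2)`, and
the defect gives `TPlus` after `z = cos θ`. The second term is `TMinus` by definition. Positivity
follows from `log(1+x) < x` for `TPlus`, and for `TMinus` from the strict decrease of `F`, the lune
being smaller than the full ball.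

`TPlus`: the defect `1 - log(1+x)/x` at `x = (2z)^d` switches on around `z = 1/2`, where `1 - z²`
equals `3/4`; this is the source of the rate `√3/2`. In the variable `x` the rescaled integrand
converges to `x^(-4/3) (1 - logRatio x)`. Dominated convergence (`plusRescaled_le`,
`tendsto_plusRescaled`), the value `π√3/2` of the limit integral and `angConst d ~ √(d/(2π))` give
the constant.

`TMinus`: the two spheres meet in a sphere of radius `h = z sin θ / dist₂`, and the overlap is at
most `h^d` or, in the remaining case, bounded. Both cases give `overlap_le_sqrt_mul`, and the
difference estimate `F_sub_F_le` turns it into `cos(θ/2)^d` times an integrable function of `u`.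
What remains is governed by the maximum `4√3/9` of `2s(1 - s²)` with `s = sin(θ/2)`. As `4√3/9 =
(8/9)(√3/2)`, `TMinus` is negligible against `TPlus`. -/

/-! ### The kernel `F`: integral representation, monotonicity, difference bound. -/

theorem F_eq_integral {z : ℝ} (hz : 0 < z) :
    F z = ∫ t in (0 : ℝ)..1, t / (1 + z * t) ^ 2 := by
  have hpos : ∀ t ∈ Icc (0 : ℝ) 1, 0 < 1 + z * t := fun t ht => by
    have := mul_nonneg hz.le ht.1
    linarith
  have hderiv : ∀ t ∈ uIcc (0 : ℝ) 1,
      HasDerivAt (fun t => (Real.log (1 + z * t) + 1 / (1 + z * t)) / z ^ 2)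
        (t / (1 + z * t) ^ 2) t := by
    intro t ht
    rw [uIcc_of_le zero_le_one] at ht
    have h0 := hpos t ht
    have h1 : HasDerivAt (fun t => 1 + z * t) z t := by
      simpa using ((hasDerivAt_id t).const_mul z).const_add 1
    have h2 := ((h1.log h0.ne').add ((hasDerivAt_const t (1 : ℝ)).div h1 h0.ne')).div_const (z ^ 2)
    refine h2.congr_deriv ?_
    have := h0.ne'
    field_simp
    ring
  have hcont : ContinuousOn (fun t : ℝ => t / (1 + z * t) ^ 2) (uIcc 0 1) := by
    rw [uIcc_of_le zero_le_one]
    refine ContinuousOn.div (by fun_prop) (by fun_prop) fun t ht => ?_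
    exact pow_ne_zero 2 (hpos t ht).ne'
  rw [intervalIntegral.integral_eq_sub_of_hasDerivAt hderiv hcont.intervalIntegrable, F]
  have : (1 + z) ≠ 0 := by positivity
  simp
  field_simp
  ring

theorem intervalIntegrable_F_kernel {z : ℝ} (hz : 0 ≤ z) :
    IntervalIntegrable (fun t : ℝ => t / (1 + z * t) ^ 2) volume 0 1 := by
  apply ContinuousOn.intervalIntegrable
  rw [uIcc_of_le zero_le_one]
  refine ContinuousOn.div (by fun_prop) (by fun_prop) fun t ht => pow_ne_zero 2 ?_
  have := mul_nonneg hz ht.1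
  positivity

theorem F_nonneg {z : ℝ} (hz : 0 < z) : 0 ≤ F z := by
  rw [F_eq_integral hz]
  refine intervalIntegral.integral_nonneg zero_le_one fun t ht => ?_
  exact div_nonneg ht.1 (sq_nonneg _)

theorem F_lt_F {x y : ℝ} (hx : 0 < x) (hxy : x < y) : F y < F x := by
  have hy := hx.trans hxy
  rw [F_eq_integral hx, F_eq_integral hy, ← sub_pos, ← intervalIntegral.integral_sub
    (intervalIntegrable_F_kernel hx.le) (intervalIntegrable_F_kernel hy.le)]
  refine intervalIntegral.intervalIntegral_pos_of_pos_on
    ((intervalIntegrable_F_kernel hx.le).sub (intervalIntegrable_F_kernel hy.le)) ?_ zero_lt_one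
  intro t ht
  have h0 : 0 < t := ht.1
  have : 0 < 1 + x * t := by positivity
  rw [sub_pos]
  gcongr

/-- The bound holds pointwise under the integral sign, since `t/(1+xt) ≤ 1/(1+x)` for `t ≤ 1`. The
quadratic decay in `x` is what later makes the bound integrable in `u` despite a factor `√u`. -/
theorem F_sub_F_le {x y : ℝ} (hx : 0 < x) (hxy : x ≤ y) :
    F x - F y ≤ 2 * (y - x) / (1 + x) ^ 2 := by
  have hy := hx.trans_le hxy
  rw [F_eq_integral hx, F_eq_integral hy, ← intervalIntegral.integral_sub
    (intervalIntegrable_F_kernel hx.le) (intervalIntegrable_F_kernel hy.le)]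
  have key : ∀ t ∈ Icc (0 : ℝ) 1, t / (1 + x * t) ^ 2 - t / (1 + y * t) ^ 2 ≤
      2 * (y - x) / (1 + x) ^ 2 := by
    intro t ht
    obtain ⟨h0, h1⟩ := ht
    have hxt : 0 ≤ x * t := by positivity
    have hyt : x * t ≤ y * t := by gcongr
    have h2 : t / (1 + x * t) ≤ 1 / (1 + x) := by
      rw [div_le_div_iff₀ (by positivity) (by positivity)]
      nlinarith
    have h3 : t / (1 + x * t) ^ 2 - t / (1 + y * t) ^ 2 =
        (t / (1 + x * t)) ^ 2 * ((y - x) * ((2 + x * t + y * t) / (1 + y * t) ^ 2)) := by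
      have : 1 + x * t ≠ 0 := by positivity
      have : 1 + y * t ≠ 0 := by nlinarith
      field_simp
      ring
    have h4 : (2 + x * t + y * t) / (1 + y * t) ^ 2 ≤ 2 := by
      rw [div_le_iff₀ (by nlinarith)]
      nlinarith
    have h5 : 0 ≤ y - x := sub_nonneg.2 hxy
    rw [h3]
    calc _ ≤ (1 / (1 + x)) ^ 2 * ((y - x) * 2) := by gcongr
      _ = _ := by rw [div_pow, one_pow]; ring
  calc _ ≤ ∫ _ in (0 : ℝ)..1, 2 * (y - x) / (1 + x) ^ 2 :=
        intervalIntegral.integral_mono_on zero_le_one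
          ((intervalIntegrable_F_kernel hx.le).sub (intervalIntegrable_F_kernel hy.le))
          (by simp) key
    _ = _ := by simp

/-! ### The antiderivative of `F`. -/

/-- `log (1 + x) / x`, extended by continuity to `x = 0`. -/
noncomputable def logRatio (x : ℝ) : ℝ := if x = 0 then 1 else Real.log (1 + x) / x

theorem logRatio_of_pos {x : ℝ} (hx : 0 < x) : logRatio x = Real.log (1 + x) / x :=
  if_neg hx.ne'

@[simp] theorem logRatio_zero : logRatio 0 = 1 := if_pos rfl

theorem logRatio_lt_one {x : ℝ} (hx : 0 < x) : logRatio x < 1 := by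
  rw [logRatio_of_pos hx, div_lt_one hx]
  have := Real.log_lt_sub_one_of_pos (x := 1 + x) (by linarith) (by linarith)
  linarith

theorem logRatio_nonneg {x : ℝ} (hx : 0 ≤ x) : 0 ≤ logRatio x := by
  rcases hx.eq_or_lt with rfl | hx
  · simp
  · rw [logRatio_of_pos hx]
    exact div_nonneg (Real.log_nonneg (by linarith)) hx.le

theorem logRatio_le_one {x : ℝ} (hx : 0 ≤ x) : logRatio x ≤ 1 := by
  rcases hx.eq_or_lt with rfl | hx
  · simp
  · exact (logRatio_lt_one hx).le

/-- From `log(1+x) ≥ x/(1+x) ≥ x(1-x)`. Vanishing to first order at `0` is what makes `x^(-4/3) (1 -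
logRatio x)` integrable there. -/
theorem one_sub_logRatio_le {x : ℝ} (hx : 0 < x) : 1 - logRatio x ≤ x := by
  rw [logRatio_of_pos hx, sub_le_comm, le_div_iff₀ hx]
  have h := Real.one_sub_inv_le_log_of_pos (x := 1 + x) (by linarith)
  refine le_trans ?_ h
  rw [← sub_nonneg]
  have : 1 - (1 + x)⁻¹ - (1 - x) * x = x ^ 3 / (1 + x) := by
    have : 1 + x ≠ 0 := by positivity
    field_simp
    ring
  rw [this]
  positivity

@[fun_prop]
theorem measurable_logRatio : Measurable logRatio := by
  unfold logRatio
  exact Measurable.ite (measurableSet_singleton 0) (by fun_prop) (by fun_prop)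

@[fun_prop]
theorem measurable_F : Measurable F := by
  unfold F
  fun_prop

theorem hasDerivAt_log_div {x : ℝ} (hx : 0 < x) :
    HasDerivAt (fun x => -(Real.log (1 + x) / x)) (F x) x := by
  have h1 : HasDerivAt (fun t : ℝ => 1 + t) 1 x := (hasDerivAt_id x).const_add 1
  have h2 := ((h1.log (by positivity)).div (hasDerivAt_id x) hx.ne').neg
  refine h2.congr_deriv ?_
  have : 1 + x ≠ 0 := by positivity
  simp only [F, id]
  field_simp
  ring

theorem tendsto_log_div_atTop :
    Tendsto (fun x : ℝ => -(Real.log (1 + x) / x)) atTop (nhds 0) := by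
  have h := Real.isLittleO_log_id_atTop.tendsto_div_nhds_zero
  have h1 : Tendsto (fun x : ℝ => Real.log (1 + x) / (1 + x)) atTop (nhds 0) :=
    h.comp (tendsto_atTop_add_const_left _ 1 tendsto_id)
  have h2 : Tendsto (fun x : ℝ => x⁻¹ + 1) atTop (nhds (0 + 1)) :=
    tendsto_inv_atTop_zero.add_const 1
  have h3 := (h1.mul h2).neg
  rw [zero_mul, neg_zero] at h3
  refine h3.congr' ?_
  filter_upwards [eventually_gt_atTop 0] with x hx
  have : 1 + x ≠ 0 := by positivity
  field_simp

theorem tendsto_log_div_zero :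
    Tendsto (fun x : ℝ => -(Real.log (1 + x) / x)) (nhdsWithin 0 (Ioi 0)) (nhds (-1)) := by
  have h : HasDerivAt (fun t : ℝ => Real.log (1 + t)) 1 0 := by
    have h1 : HasDerivAt (fun t : ℝ => 1 + t) 1 0 := (hasDerivAt_id _).const_add 1
    simpa using h1.log (by norm_num)
  have h2 := (hasDerivAt_iff_tendsto_slope.1 h).mono_left
    (nhdsWithin_mono 0 (fun x (hx : (0 : ℝ) < x) => hx.ne'))
  refine h2.neg.congr fun x => ?_
  simp [slope_def_field]

theorem tendsto_log_div {a : ℝ} (ha : 0 ≤ a) :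
    Tendsto (fun x : ℝ => -(Real.log (1 + x) / x)) (nhdsWithin a (Ioi a))
      (nhds (-logRatio a)) := by
  rcases ha.eq_or_lt with rfl | ha
  · simpa using tendsto_log_div_zero
  · rw [logRatio_of_pos ha]
    exact (hasDerivAt_log_div ha).continuousAt.tendsto.mono_left nhdsWithin_le_nhds

theorem hasDerivAt_neg_logRatio {x : ℝ} (hx : 0 < x) :
    HasDerivAt (fun x => -logRatio x) (F x) x := by
  refine (hasDerivAt_log_div hx).congr_of_eventuallyEq ?_
  filter_upwards [eventually_gt_nhds hx] with y hy
  rw [logRatio_of_pos hy]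

theorem continuousWithinAt_neg_logRatio {a : ℝ} (ha : 0 ≤ a) :
    ContinuousWithinAt (fun x => -logRatio x) (Ici a) a := by
  rw [← continuousWithinAt_Ioi_iff_Ici, ContinuousWithinAt]
  refine (tendsto_log_div ha).congr' ?_
  filter_upwards [self_mem_nhdsWithin] with y hy
  rw [logRatio_of_pos (ha.trans_lt hy)]

theorem tendsto_neg_logRatio_atTop : Tendsto (fun x => -logRatio x) atTop (nhds 0) := by
  refine tendsto_log_div_atTop.congr' ?_
  filter_upwards [eventually_gt_atTop 0] with y hy
  rw [logRatio_of_pos hy]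

theorem integrableOn_F {a : ℝ} (ha : 0 ≤ a) : IntegrableOn F (Ioi a) :=
  integrableOn_Ioi_deriv_of_nonneg (continuousWithinAt_neg_logRatio ha)
    (fun _ hx => hasDerivAt_neg_logRatio (ha.trans_lt hx))
    (fun _ hx => F_nonneg (ha.trans_lt hx)) tendsto_neg_logRatio_atTop

theorem integral_F {a : ℝ} (ha : 0 ≤ a) : ∫ x in Ioi a, F x = logRatio a := by
  rw [integral_Ioi_of_hasDerivAt_of_nonneg (continuousWithinAt_neg_logRatio ha)
    (fun _ hx => hasDerivAt_neg_logRatio (ha.trans_lt hx))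
    (fun _ hx => F_nonneg (ha.trans_lt hx)) tendsto_neg_logRatio_atTop]
  simp

/-! ### Ball volumes and the angular normalising constant. -/

theorem V_pos (d : ℕ) : 0 < V d := by
  unfold V
  have : 0 < Real.Gamma ((d : ℝ) / 2 + 1) := Real.Gamma_pos_of_pos (by positivity)
  positivity

theorem V_ratio {d : ℕ} (hd : 1 ≤ d) :
    V (d - 1) / V d = Real.Gamma ((d : ℝ) / 2 + 1) / (√Real.pi * Real.Gamma ((d + 1 : ℝ) / 2)) := by
  have h1 : 0 < Real.Gamma ((d : ℝ) / 2 + 1) := Real.Gamma_pos_of_pos (by positivity)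
  have h2 : 0 < Real.Gamma ((d + 1 : ℝ) / 2) := Real.Gamma_pos_of_pos (by positivity)
  have h3 : (Real.pi : ℝ) ^ ((d : ℝ) / 2) = √Real.pi * Real.pi ^ (((d - 1 : ℕ) : ℝ) / 2) := by
    rw [Real.sqrt_eq_rpow, ← Real.rpow_add Real.pi_pos]
    congr 1
    push_cast [Nat.cast_sub hd]
    ring
  have h4 : ((d - 1 : ℕ) : ℝ) / 2 + 1 = (d + 1 : ℝ) / 2 := by
    push_cast [Nat.cast_sub hd]
    ring
  rw [V, V, h3, h4]
  have : 0 < Real.pi ^ (((d - 1 : ℕ) : ℝ) / 2) := by positivity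
  have : 0 < √Real.pi := by positivity
  field_simp

theorem integral_sin_pow_eq_Gamma (n : ℕ) :
    ∫ θ in (0 : ℝ)..Real.pi, Real.sin θ ^ n =
      √Real.pi * Real.Gamma ((n + 1 : ℝ) / 2) / Real.Gamma ((n : ℝ) / 2 + 1) := by
  induction n using Nat.twoStepInduction with
  | zero =>
    simp only [pow_zero, intervalIntegral.integral_const, Nat.cast_zero, zero_add, zero_div,
      Real.Gamma_one, Real.Gamma_one_half_eq, Real.mul_self_sqrt Real.pi_pos.le]
    simp
  | one =>
    have h : Real.Gamma ((1 : ℝ) / 2 + 1) = 1 / 2 * √Real.pi := by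
      rw [Real.Gamma_add_one (by norm_num), Real.Gamma_one_half_eq]
    have : 0 < √Real.pi := by positivity
    simp only [pow_one, integral_sin, Nat.cast_one, h]
    norm_num
    field_simp
  | more n ih _ =>
    have h1 : 0 < Real.Gamma ((n : ℝ) / 2 + 1) := Real.Gamma_pos_of_pos (by positivity)
    have e1 : ((n + 2 : ℕ) + 1 : ℝ) / 2 = (n + 1 : ℝ) / 2 + 1 := by push_cast; ring
    have e2 : ((n + 2 : ℕ) : ℝ) / 2 + 1 = ((n : ℝ) / 2 + 1) + 1 := by push_cast; ring
    rw [integral_sin_pow, ih, e1, e2, Real.Gamma_add_one (s := (n + 1 : ℝ) / 2) (by positivity),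
      Real.Gamma_add_one (s := (n : ℝ) / 2 + 1) (by positivity)]
    simp only [Real.sin_zero, Real.sin_pi, ne_eq, Nat.add_eq_zero_iff, one_ne_zero, and_false,
      not_false_eq_true, zero_pow, zero_mul, sub_zero, zero_div, zero_add]
    field_simp

theorem V_ratio_mul_integral_sin_pow {d : ℕ} (hd : 1 ≤ d) :
    V (d - 1) / V d * ∫ θ in (0 : ℝ)..Real.pi, Real.sin θ ^ d = 1 := by
  have h1 : 0 < Real.Gamma ((d : ℝ) / 2 + 1) := Real.Gamma_pos_of_pos (by positivity)
  have h2 : 0 < Real.Gamma ((d + 1 : ℝ) / 2) := Real.Gamma_pos_of_pos (by positivity)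
  have : 0 < √Real.pi := by positivity
  rw [V_ratio hd, integral_sin_pow_eq_Gamma]
  field_simp

/-- The normalising constant of the angular density `sin θ ^ (d - 2)`. -/
noncomputable def angConst (d : ℕ) : ℝ := ((d : ℝ) - 1) * V (d - 1) / ((d : ℝ) * V d)

theorem angConst_pos {d : ℕ} (hd : 2 ≤ d) : 0 < angConst d := by
  have := V_pos d
  have := V_pos (d - 1)
  have : (2 : ℝ) ≤ d := by exact_mod_cast hd
  have : 0 < (d : ℝ) - 1 := by linarith
  unfold angConst
  positivity

/-- The factor `(d-1)/d` in `angConst` is the one in Wallis' recurrence from `sin^(d-2)` to `sin^d`.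
-/
theorem angConst_mul_integral {d : ℕ} (hd : 2 ≤ d) :
    angConst d * ∫ θ in (0 : ℝ)..Real.pi, Real.sin θ ^ (d - 2) = 1 := by
  rw [← V_ratio_mul_integral_sin_pow (d := d) (by omega)]
  obtain ⟨n, rfl⟩ := Nat.exists_eq_add_of_le' hd
  rw [integral_sin_pow, angConst]
  have := V_pos (n + 2)
  simp only [Real.sin_zero, Real.sin_pi, ne_eq, Nat.add_eq_zero_iff, one_ne_zero, and_false,
      not_false_eq_true, zero_pow, zero_mul, sub_zero, zero_div, zero_add, Nat.add_sub_cancel]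
  push_cast
  field_simp
  ring

/-- Log-convexity of `Γ` at the midpoint of `x` and `x + 1`. Used at `d/2` and at `(d+1)/2`, it
encloses the ratio of volumes tightly enough to avoid Stirling's formula. -/
theorem Gamma_add_half_sq_le {x : ℝ} (hx : 0 < x) :
    Real.Gamma (x + 1 / 2) ≤ √x * Real.Gamma x := by
  have h := Real.Gamma_mul_add_mul_le_rpow_Gamma_mul_rpow_Gamma hx (t := x + 1)
    (by positivity) (a := 1 / 2) (b := 1 / 2) (by norm_num) (by norm_num) (by norm_num)
  have hG := Real.Gamma_pos_of_pos hx
  rw [Real.Gamma_add_one hx.ne', ← Real.sqrt_eq_rpow, ← Real.sqrt_eq_rpow,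
    Real.sqrt_mul hx.le] at h
  calc _ = Real.Gamma (1 / 2 * x + 1 / 2 * (x + 1)) := by congr 1; ring
    _ ≤ _ := h
    _ = √x * (√(Real.Gamma x) * √(Real.Gamma x)) := by ring
    _ = _ := by rw [Real.mul_self_sqrt hG.le]

theorem tendsto_angConst_div_sqrt :
    Tendsto (fun d : ℕ => angConst d / √(d : ℝ)) atTop (nhds (1 / √(2 * Real.pi))) := by
  set q : ℕ → ℝ := fun d => Real.Gamma ((d : ℝ) / 2 + 1) / Real.Gamma ((d + 1 : ℝ) / 2) with hq
  have hlow : ∀ d : ℕ, 1 ≤ d → √((d : ℝ) / 2) ≤ q d := by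
    intro d hd
    have hd' : (0 : ℝ) < d := by exact_mod_cast hd
    have h := Gamma_add_half_sq_le (x := (d : ℝ) / 2) (by positivity)
    have h2 : 0 < Real.Gamma ((d + 1 : ℝ) / 2) := Real.Gamma_pos_of_pos (by positivity)
    rw [hq, le_div_iff₀ h2, Real.Gamma_add_one (by positivity)]
    have e : (d : ℝ) / 2 + 1 / 2 = (d + 1 : ℝ) / 2 := by ring
    rw [e] at h
    calc _ ≤ √((d : ℝ) / 2) * (√((d : ℝ) / 2) * Real.Gamma ((d : ℝ) / 2)) := by gcongr
      _ = _ := by rw [← mul_assoc, Real.mul_self_sqrt (by positivity)]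
  have hupp : ∀ d : ℕ, q d ≤ √((d + 1 : ℝ) / 2) := by
    intro d
    have h := Gamma_add_half_sq_le (x := (d + 1 : ℝ) / 2) (by positivity)
    have h2 : 0 < Real.Gamma ((d + 1 : ℝ) / 2) := Real.Gamma_pos_of_pos (by positivity)
    rw [hq, div_le_iff₀ h2]
    have e : (d + 1 : ℝ) / 2 + 1 / 2 = d / 2 + 1 := by ring
    rwa [e] at h
  have hinv : Tendsto (fun d : ℕ => 1 / (d : ℝ)) atTop (nhds 0) := tendsto_one_div_atTop_nhds_zero_nat
  have hq' : Tendsto (fun d : ℕ => q d / √(d : ℝ)) atTop (nhds (√(1 / 2))) := by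
    have hu : Tendsto (fun d : ℕ => √((1 + 1 / (d : ℝ)) / 2)) atTop (nhds (√((1 + 0) / 2))) :=
      ((hinv.const_add 1).div_const 2).sqrt
    rw [add_zero] at hu
    refine tendsto_of_tendsto_of_tendsto_of_le_of_le' tendsto_const_nhds hu ?_ ?_
    · filter_upwards [eventually_ge_atTop 1] with d hd
      have hd' : (0 : ℝ) < d := by exact_mod_cast hd
      rw [le_div_iff₀ (by positivity), ← Real.sqrt_mul (by positivity)]
      refine le_trans (le_of_eq ?_) (hlow d hd)
      congr 1; ring
    · filter_upwards [eventually_ge_atTop 1] with d hd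
      have hd' : (0 : ℝ) < d := by exact_mod_cast hd
      rw [div_le_iff₀ (by positivity), ← Real.sqrt_mul (by positivity)]
      refine (hupp d).trans (le_of_eq ?_)
      congr 1; field_simp
  have h := ((hinv.const_sub 1).mul hq').div_const (√Real.pi)
  have e : (1 - 0) * √(1 / 2) / √Real.pi = 1 / √(2 * Real.pi) := by
    rw [Real.sqrt_mul (by norm_num), Real.sqrt_div (by norm_num), Real.sqrt_one]
    field_simp
    ring
  rw [e] at h
  refine h.congr' ?_
  filter_upwards [eventually_ge_atTop 1] with d hd
  have hd' : (0 : ℝ) < d := by exact_mod_cast hd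
  rw [angConst, mul_div_mul_comm, V_ratio hd, hq]
  field_simp

/-! ### Spherical caps. -/

/-- The normalised volume of the cap of the `d`-dimensional unit ball at height `c`. -/
noncomputable def cap (d : ℕ) (c : ℝ) : ℝ :=
  V (d - 1) / V d * ∫ x in c..(1 : ℝ), (1 - x ^ 2) ^ (((d : ℝ) - 1) / 2)

theorem continuous_capDensity {d : ℕ} (hd : 1 ≤ d) :
    Continuous fun x : ℝ => (1 - x ^ 2) ^ (((d : ℝ) - 1) / 2) := by
  have h : (0 : ℝ) ≤ ((d : ℝ) - 1) / 2 := by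
    have : (1 : ℝ) ≤ d := by exact_mod_cast hd
    linarith
  exact Continuous.rpow_const (by fun_prop) fun _ => Or.inr h

theorem continuous_cap {d : ℕ} (hd : 1 ≤ d) : Continuous (cap d) := by
  have h := intervalIntegral.continuous_primitive (μ := volume)
    (fun a b => (continuous_capDensity hd).intervalIntegrable a b) 1
  have e : cap d = fun c => V (d - 1) / V d *
      -∫ x in (1 : ℝ)..c, (1 - x ^ 2) ^ (((d : ℝ) - 1) / 2) := by
    ext c
    rw [cap, intervalIntegral.integral_symm]
  rw [e]
  exact h.neg.const_mul _

theorem integral_capDensity {d : ℕ} (hd : 1 ≤ d) :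
    ∫ x in (-1 : ℝ)..1, (1 - x ^ 2) ^ (((d : ℝ) - 1) / 2) =
      ∫ θ in (0 : ℝ)..Real.pi, Real.sin θ ^ d := by
  have h := intervalIntegral.integral_comp_mul_deriv (a := Real.pi) (b := 0)
    (f := Real.cos) (f' := fun θ => -Real.sin θ) (fun x _ => Real.hasDerivAt_cos x)
    (by fun_prop) (continuous_capDensity hd)
  rw [Real.cos_pi, Real.cos_zero] at h
  rw [← h, intervalIntegral.integral_symm, ← intervalIntegral.integral_neg]
  refine intervalIntegral.integral_congr fun θ hθ => ?_
  rw [uIcc_of_le Real.pi_pos.le] at hθ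
  have hs := Real.sin_nonneg_of_mem_Icc hθ
  simp only [Function.comp_apply]
  rw [← Real.sin_sq, ← Real.rpow_natCast, ← Real.rpow_mul hs]
  obtain ⟨n, rfl⟩ := Nat.exists_eq_add_of_le' hd
  have e : ((2 : ℕ) : ℝ) * (((n + 1 : ℕ) - 1 : ℝ) / 2) = n := by push_cast; ring
  rw [e, Real.rpow_natCast]
  ring

theorem cap_neg_one {d : ℕ} (hd : 1 ≤ d) : cap d (-1) = 1 := by
  rw [cap, integral_capDensity hd, V_ratio_mul_integral_sin_pow hd]

theorem capDensity_nonneg (d : ℕ) {x : ℝ} (h1 : -1 ≤ x) (h2 : x ≤ 1) :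
    (0 : ℝ) ≤ (1 - x ^ 2) ^ (((d : ℝ) - 1) / 2) :=
  Real.rpow_nonneg (by nlinarith) _

theorem cap_nonneg (d : ℕ) {c : ℝ} (h1 : -1 ≤ c) (h2 : c ≤ 1) : 0 ≤ cap d c := by
  have := V_pos d
  have := V_pos (d - 1)
  refine mul_nonneg (by positivity) (intervalIntegral.integral_nonneg h2 fun x hx => ?_)
  exact capDensity_nonneg d (h1.trans hx.1) hx.2

theorem cap_pos {d : ℕ} (hd : 1 ≤ d) {c : ℝ} (h1 : -1 ≤ c) (h2 : c < 1) : 0 < cap d c := by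
  have := V_pos d
  have := V_pos (d - 1)
  refine mul_pos (by positivity) (intervalIntegral.intervalIntegral_pos_of_pos_on
    ((continuous_capDensity hd).intervalIntegrable _ _) (fun x hx => ?_) h2)
  have : -1 < x := h1.trans_lt hx.1
  have : x < 1 := hx.2
  exact Real.rpow_pos_of_pos (by nlinarith) _

theorem cap_add_integral (d : ℕ) (hd : 1 ≤ d) (c : ℝ) :
    cap d c = cap d (-1) - V (d - 1) / V d *
      ∫ x in (-1 : ℝ)..c, (1 - x ^ 2) ^ (((d : ℝ) - 1) / 2) := by
  have hi := (continuous_capDensity hd).intervalIntegrable (μ := volume)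
  rw [cap, cap, ← mul_sub, ← intervalIntegral.integral_add_adjacent_intervals (hi (-1) c) (hi c 1)]
  ring

theorem cap_le_one {d : ℕ} (hd : 1 ≤ d) {c : ℝ} (h1 : -1 ≤ c) (h2 : c ≤ 1) : cap d c ≤ 1 := by
  have := V_pos d
  have := V_pos (d - 1)
  rw [cap_add_integral d hd, cap_neg_one hd]
  have : 0 ≤ V (d - 1) / V d * ∫ x in (-1 : ℝ)..c, (1 - x ^ 2) ^ (((d : ℝ) - 1) / 2) := by
    refine mul_nonneg (by positivity) (intervalIntegral.integral_nonneg h1 fun x hx => ?_)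
    exact capDensity_nonneg d hx.1 (hx.2.trans h2)
  linarith

theorem cap_neg (d : ℕ) (c : ℝ) :
    V (d - 1) / V d * (∫ x in (-1 : ℝ)..(-c), (1 - x ^ 2) ^ (((d : ℝ) - 1) / 2)) = cap d c := by
  rw [cap, ← intervalIntegral.integral_comp_neg]
  simp

theorem cap_zero {d : ℕ} (hd : 1 ≤ d) : cap d 0 = 1 / 2 := by
  have h := cap_add_integral d hd 0
  have h2 := cap_neg d 0
  rw [neg_zero] at h2
  rw [h2, cap_neg_one hd] at h
  linarith

/-- A cap smaller than a half ball is contained in a half ball on its base. -/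
theorem cap_le {d : ℕ} (hd : 1 ≤ d) {c s : ℝ} (hc0 : 0 ≤ c) (hs0 : 0 ≤ s)
    (hcs : c ^ 2 + s ^ 2 = 1) : cap d c ≤ 1 / 2 * s ^ d := by
  have hd' : (1 : ℝ) ≤ d := by exact_mod_cast hd
  set e : ℝ := ((d : ℝ) - 1) / 2 with he
  have he0 : 0 ≤ e := by rw [he]; linarith
  have hVV : 0 ≤ V (d - 1) / V d := (div_pos (V_pos _) (V_pos _)).le
  have hc1 : c ≤ 1 := by nlinarith
  have hs1 : 1 - c ≤ s := by nlinarith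
  have hcont : Continuous fun t : ℝ => (s ^ 2 - t ^ 2) ^ e :=
    Continuous.rpow_const (by fun_prop) fun _ => Or.inr he0
  have h1 : ∫ x in c..(1 : ℝ), (1 - x ^ 2) ^ e = ∫ t in (0 : ℝ)..(1 - c), (1 - (t + c) ^ 2) ^ e := by
    rw [intervalIntegral.integral_comp_add_right (fun x => (1 - x ^ 2) ^ e)]
    simp
  have h2 : ∫ t in (0 : ℝ)..(1 - c), (1 - (t + c) ^ 2) ^ e ≤
      ∫ t in (0 : ℝ)..(1 - c), (s ^ 2 - t ^ 2) ^ e := by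
    refine intervalIntegral.integral_mono_on (by linarith)
      (((continuous_capDensity hd).comp (by fun_prop : Continuous fun t : ℝ => t + c)).intervalIntegrable _ _)
      (hcont.intervalIntegrable _ _) fun t ht => ?_
    obtain ⟨ht0, ht1⟩ := ht
    exact Real.rpow_le_rpow (by nlinarith) (by nlinarith) he0
  have h3 : ∫ t in (0 : ℝ)..(1 - c), (s ^ 2 - t ^ 2) ^ e ≤ ∫ t in (0 : ℝ)..s, (s ^ 2 - t ^ 2) ^ e := by
    refine intervalIntegral.integral_mono_interval le_rfl (by linarith) hs1 ?_
      (hcont.intervalIntegrable _ _)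
    refine (ae_restrict_iff' measurableSet_Ioc).2 (.of_forall fun t ht => ?_)
    exact Real.rpow_nonneg (by nlinarith [ht.1, ht.2]) _
  have h4 : ∫ t in (0 : ℝ)..s, (s ^ 2 - t ^ 2) ^ e =
      s ^ d * ∫ x in (0 : ℝ)..1, (1 - x ^ 2) ^ e := by
    have h := intervalIntegral.smul_integral_comp_mul_left (a := 0) (b := 1)
      (fun t : ℝ => (s ^ 2 - t ^ 2) ^ e) s
    rw [mul_zero, mul_one, smul_eq_mul] at h
    rw [← h, ← intervalIntegral.integral_const_mul, ← intervalIntegral.integral_const_mul]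
    refine intervalIntegral.integral_congr fun x hx => ?_
    rw [uIcc_of_le zero_le_one] at hx
    have e1 : s ^ 2 - (s * x) ^ 2 = s ^ 2 * (1 - x ^ 2) := by ring
    rw [e1, Real.mul_rpow (by positivity) (by nlinarith [hx.1, hx.2]), ← mul_assoc,
      ← Real.rpow_natCast s 2, ← Real.rpow_mul hs0]
    obtain ⟨n, rfl⟩ := Nat.exists_eq_add_of_le' hd
    have e2 : ((2 : ℕ) : ℝ) * e = n := by rw [he]; push_cast; ring
    rw [e2, Real.rpow_natCast]
    ring
  have h5 := cap_zero hd
  rw [cap] at h5 ⊢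
  calc _ ≤ V (d - 1) / V d * (s ^ d * ∫ x in (0 : ℝ)..1, (1 - x ^ 2) ^ e) := by
        rw [h1, ← h4]; gcongr; exact h2.trans h3
    _ = (V (d - 1) / V d * ∫ x in (0 : ℝ)..1, (1 - x ^ 2) ^ e) * s ^ d := by ring
    _ = _ := by rw [h5]

/-! ### Geometry of two intersecting balls. -/

/-- The distance between the centres of the two balls. -/
noncomputable def dist₂ (z θ : ℝ) : ℝ := √(1 + z ^ 2 - 2 * z * Real.cos θ)

theorem lune_eq (d : ℕ) (z θ : ℝ) :
    lune d z θ = z ^ d - (cap d ((1 - z * Real.cos θ) / dist₂ z θ) +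
      z ^ d * cap d ((z - Real.cos θ) / dist₂ z θ)) := by
  have e1 : (1 - z * Real.cos θ) ^ 2 + (z * Real.sin θ) ^ 2 = 1 + z ^ 2 - 2 * z * Real.cos θ := by
    rw [mul_pow, Real.sin_sq]; ring
  have e2 : (Real.cos θ - z) ^ 2 + Real.sin θ ^ 2 = 1 + z ^ 2 - 2 * z * Real.cos θ := by
    rw [Real.sin_sq]; ring
  have e3 : (Real.cos θ - z) / dist₂ z θ = -((z - Real.cos θ) / dist₂ z θ) := by ring
  rw [lune, e1, e2, ← dist₂, e3, ← cap_neg d ((z - Real.cos θ) / dist₂ z θ), cap]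
  ring

theorem measurable_lune {d : ℕ} (hd : 1 ≤ d) :
    Measurable fun p : ℝ × ℝ => lune d p.1 p.2 := by
  have hc := (continuous_cap hd).measurable
  simp only [lune_eq, dist₂]
  have h1 : Measurable fun p : ℝ × ℝ =>
      (1 - p.1 * Real.cos p.2) / √(1 + p.1 ^ 2 - 2 * p.1 * Real.cos p.2) := by fun_prop
  have h2 : Measurable fun p : ℝ × ℝ =>
      (p.1 - Real.cos p.2) / √(1 + p.1 ^ 2 - 2 * p.1 * Real.cos p.2) := by fun_prop
  exact (measurable_fst.pow_const d).sub
    ((hc.comp h1).add ((measurable_fst.pow_const d).mul (hc.comp h2)))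

section Geometry

variable {d : ℕ} {z θ : ℝ}

theorem pos_of_zMin_lt (hz : zMin θ < z) : 0 < z := (le_max_right _ _).trans_lt hz

theorem two_cos_lt (hz : zMin θ < z) : 2 * Real.cos θ < z := (le_max_left _ _).trans_lt hz

theorem cos_lt_of_zMin_lt (hz : zMin θ < z) : Real.cos θ < z := by
  have := pos_of_zMin_lt hz
  have := two_cos_lt hz
  linarith

theorem dist₂_sq (hz : zMin θ < z) : dist₂ z θ ^ 2 = 1 + z ^ 2 - 2 * z * Real.cos θ := by
  refine Real.sq_sqrt ?_
  have := pos_of_zMin_lt hz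
  have := two_cos_lt hz
  nlinarith

/-- Consider the triangle formed by the two centres and a common point of the spheres, with sides
`1`, `z` enclosing the angle `θ`. Being beyond `zMin θ` makes the third side longer than `1`. -/
theorem one_lt_dist₂ (hz : zMin θ < z) : 1 < dist₂ z θ := by
  have h := dist₂_sq hz
  have := pos_of_zMin_lt hz
  have := two_cos_lt hz
  have : 0 ≤ dist₂ z θ := Real.sqrt_nonneg _
  nlinarith

theorem angle₁_sq (hz : zMin θ < z) :
    ((1 - z * Real.cos θ) / dist₂ z θ) ^ 2 + (z * Real.sin θ / dist₂ z θ) ^ 2 = 1 := by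
  have h := dist₂_sq hz
  have := one_lt_dist₂ hz
  rw [div_pow, div_pow, ← add_div, h, div_eq_one_iff_eq (by rw [← h]; positivity), mul_pow,
    Real.sin_sq]
  ring

theorem angle₂_sq (hz : zMin θ < z) :
    ((z - Real.cos θ) / dist₂ z θ) ^ 2 + (Real.sin θ / dist₂ z θ) ^ 2 = 1 := by
  have h := dist₂_sq hz
  have := one_lt_dist₂ hz
  rw [div_pow, div_pow, ← add_div, h, div_eq_one_iff_eq (by rw [← h]; positivity), Real.sin_sq]
  ring

/-- The normalised volume of the intersection of the two balls. -/
noncomputable def overlap (d : ℕ) (z θ : ℝ) : ℝ :=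
  cap d ((1 - z * Real.cos θ) / dist₂ z θ) + z ^ d * cap d ((z - Real.cos θ) / dist₂ z θ)

theorem lune_eq_sub_overlap (d : ℕ) (z θ : ℝ) : lune d z θ = z ^ d - overlap d z θ :=
  lune_eq d z θ

theorem angle₁_mem (hz : zMin θ < z) : |(1 - z * Real.cos θ) / dist₂ z θ| ≤ 1 := by
  rw [← sq_le_one_iff_abs_le_one]
  nlinarith [angle₁_sq hz, sq_nonneg (z * Real.sin θ / dist₂ z θ)]

theorem angle₂_mem (hz : zMin θ < z) : |(z - Real.cos θ) / dist₂ z θ| ≤ 1 := by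
  rw [← sq_le_one_iff_abs_le_one]
  nlinarith [angle₂_sq hz, sq_nonneg (Real.sin θ / dist₂ z θ)]

theorem overlap_nonneg (hz : zMin θ < z) : 0 ≤ overlap d z θ := by
  have h1 := abs_le.1 (angle₁_mem hz)
  have h2 := abs_le.1 (angle₂_mem hz)
  have := cap_nonneg d h1.1 h1.2
  have := cap_nonneg d h2.1 h2.2
  have := pos_of_zMin_lt hz
  unfold overlap
  positivity

theorem overlap_pos (hd : 1 ≤ d) (hθ : 0 < Real.sin θ) (hz : zMin θ < z) :
    0 < overlap d z θ := by
  have h1 := abs_le.1 (angle₁_mem hz)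
  have h2 := abs_le.1 (angle₂_mem hz)
  have h0 := pos_of_zMin_lt hz
  have hD := one_lt_dist₂ hz
  have h3 : (1 - z * Real.cos θ) / dist₂ z θ < 1 := by
    have h4 : 0 < (z * Real.sin θ / dist₂ z θ) ^ 2 := by positivity
    nlinarith [angle₁_sq hz]
  have := cap_pos hd h1.1 h3
  have := cap_nonneg d h2.1 h2.2
  unfold overlap
  positivity

theorem cap₂_le (hd : 1 ≤ d) (hθ : 0 ≤ Real.sin θ) (hz : zMin θ < z) :
    z ^ d * cap d ((z - Real.cos θ) / dist₂ z θ) ≤ 1 / 2 * (z * Real.sin θ / dist₂ z θ) ^ d := by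
  have h0 := pos_of_zMin_lt hz
  have hD := one_lt_dist₂ hz
  have h1 := cos_lt_of_zMin_lt hz
  have h2 := cap_le hd (c := (z - Real.cos θ) / dist₂ z θ) (s := Real.sin θ / dist₂ z θ)
    (div_nonneg (by linarith) (by linarith)) (by positivity) (angle₂_sq hz)
  calc _ ≤ z ^ d * (1 / 2 * (Real.sin θ / dist₂ z θ) ^ d) := by gcongr
    _ = _ := by rw [mul_div_assoc, mul_pow]; ring

/-- Both caps are then at most half balls and share a base of radius `z sin θ / dist₂`, so each is
at most half a ball on that base. The cap of the ball of radius `z` is always of this kind, as `cos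
θ < z`. -/
theorem overlap_le_of_acute (hd : 1 ≤ d) (hθ : 0 ≤ Real.sin θ) (hz : zMin θ < z)
    (h : z * Real.cos θ ≤ 1) : overlap d z θ ≤ (z * Real.sin θ / dist₂ z θ) ^ d := by
  have h0 := pos_of_zMin_lt hz
  have hD := one_lt_dist₂ hz
  have h2 := cap_le hd (c := (1 - z * Real.cos θ) / dist₂ z θ) (s := z * Real.sin θ / dist₂ z θ)
    (div_nonneg (by linarith) (by linarith)) (by positivity) (angle₁_sq hz)
  have h3 := cap₂_le hd hθ hz
  unfold overlap
  linarith

theorem height_le_one (hz : zMin θ < z) : z * Real.sin θ / dist₂ z θ ≤ 1 := by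
  refine (abs_le.1 ?_).2
  rw [← sq_le_one_iff_abs_le_one]
  nlinarith [angle₁_sq hz, sq_nonneg ((1 - z * Real.cos θ) / dist₂ z θ)]

theorem overlap_le (hd : 1 ≤ d) (hθ : 0 ≤ Real.sin θ) (hz : zMin θ < z) :
    overlap d z θ ≤ 3 / 2 := by
  have h0 := pos_of_zMin_lt hz
  have hD := one_lt_dist₂ hz
  have h1 := abs_le.1 (angle₁_mem hz)
  have h2 := cap_le_one hd h1.1 h1.2
  have h3 := cap₂_le hd hθ hz
  have h4 : (z * Real.sin θ / dist₂ z θ) ^ d ≤ 1 :=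
    pow_le_one₀ (by positivity) (height_le_one hz)
  unfold overlap
  linarith

/-- In the acute case the base radius is less than `z`. Otherwise `z² > 2 z cos θ > 2`, so `z^d`
exceeds the general bound `3/2` on the overlap. -/
theorem lune_pos (hd : 2 ≤ d) (hθ : 0 ≤ Real.sin θ) (hz : zMin θ < z) : 0 < lune d z θ := by
  have h0 := pos_of_zMin_lt hz
  have hD := one_lt_dist₂ hz
  rw [lune_eq_sub_overlap, sub_pos]
  rcases le_or_gt (z * Real.cos θ) 1 with h | h
  · refine (overlap_le_of_acute (by omega) hθ hz h).trans_lt ?_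
    have h1 : Real.sin θ / dist₂ z θ < 1 := by
      have h2 : 0 < ((z - Real.cos θ) / dist₂ z θ) ^ 2 := by
        have := sub_pos.2 (cos_lt_of_zMin_lt hz)
        positivity
      nlinarith [angle₂_sq hz]
    rw [mul_div_assoc]
    exact pow_lt_pow_left₀ (by nlinarith) (by positivity) (by omega)
  · refine (overlap_le (by omega) hθ hz).trans_lt ?_
    have h1 := two_cos_lt hz
    have h2 : 2 < z ^ 2 := by nlinarith
    have h3 : 1 ≤ z := by nlinarith
    have := pow_le_pow_right₀ h3 hd
    linarith

/-- The squared distance is `(1-z)² + 4z sin²(θ/2) ≥ 4z sin²(θ/2)`, so the base radius is at most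
`√z cos(θ/2)`. This separates `z` from `θ`. In the obtuse case `z cos²(θ/2) = (z + z cos θ)/2 ≥ 1`,
and the bound `3/2` suffices. -/
theorem overlap_le_sqrt_mul (hd : 1 ≤ d) (hθ : θ ∈ Icc 0 Real.pi) (hz : zMin θ < z) :
    overlap d z θ ≤ 3 / 2 * (√(z ^ d) * Real.cos (θ / 2) ^ d) := by
  have h0 := pos_of_zMin_lt hz
  have hD := one_lt_dist₂ hz
  have hs : 0 ≤ Real.sin θ := Real.sin_nonneg_of_mem_Icc hθ
  have hc : 0 ≤ Real.cos (θ / 2) := Real.cos_nonneg_of_mem_Icc ⟨by linarith [hθ.1, Real.pi_pos], by linarith [hθ.2]⟩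
  have hcos : Real.cos θ = 2 * Real.cos (θ / 2) ^ 2 - 1 := by
    rw [← Real.cos_two_mul]; congr 1; ring
  have hsz : √(z ^ d) = √z ^ d := by
    rw [Real.sqrt_eq_iff_mul_self_eq (by positivity) (by positivity), ← mul_pow,
      Real.mul_self_sqrt h0.le]
  rw [hsz, ← mul_pow]
  rcases le_or_gt (z * Real.cos θ) 1 with h | h
  · have h1 : z * Real.sin θ / dist₂ z θ ≤ √z * Real.cos (θ / 2) := by
      refine (sq_le_sq₀ (by positivity) (by positivity)).1 ?_
      rw [div_pow, mul_pow, mul_pow, Real.sq_sqrt h0.le, dist₂_sq hz, div_le_iff₀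
        (by rw [← dist₂_sq hz]; positivity), Real.sin_sq, hcos]
      have : 0 ≤ z * Real.cos (θ / 2) ^ 2 * (1 - z) ^ 2 := by positivity
      nlinarith
    have h2 := pow_le_pow_left₀ (by positivity) h1 d
    have h3 := overlap_le_of_acute hd hs hz h
    have : 0 ≤ (√z * Real.cos (θ / 2)) ^ d := by positivity
    linarith
  · have h1 : 1 ≤ √z * Real.cos (θ / 2) := by
      refine (sq_le_sq₀ (by positivity) (by positivity)).1 ?_
      rw [mul_pow, Real.sq_sqrt h0.le]
      have : 1 ≤ z := by nlinarith [Real.cos_le_one θ]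
      nlinarith
    have := overlap_le hd hs hz
    have := one_le_pow₀ h1 (n := d)
    linarith

end Geometry

/-! ### Inner integrals at a fixed angle. -/

theorem zMin_nonneg (θ : ℝ) : 0 ≤ zMin θ := le_max_right _ _

theorem continuous_zMin : Continuous zMin := by
  unfold zMin
  fun_prop

section Inner

variable {d : ℕ} {θ u : ℝ}

theorem rpow_one_div_pow (hd : 1 ≤ d) (hu : 0 ≤ u) : (u ^ (1 / (d : ℝ))) ^ d = u := by
  rw [one_div]
  exact Real.rpow_inv_natCast_pow hu (by omega)

theorem zMin_lt_rpow (hd : 1 ≤ d) (hu : zMin θ ^ d < u) : zMin θ < u ^ (1 / (d : ℝ)) := by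
  have h0 : 0 ≤ u := (pow_nonneg (zMin_nonneg θ) d).trans hu.le
  refine lt_of_pow_lt_pow_left₀ d (by positivity) ?_
  rwa [rpow_one_div_pow hd h0]

theorem pos_of_zMin_pow_lt (hu : zMin θ ^ d < u) : 0 < u :=
  (pow_nonneg (zMin_nonneg θ) d).trans_lt hu

theorem minusIntegrand_nonneg (hd : 2 ≤ d) (hθ : θ ∈ Icc 0 Real.pi) (hu : zMin θ ^ d < u) :
    0 ≤ minusIntegrand d θ u := by
  have hz := zMin_lt_rpow (by omega) hu
  have h1 := lune_pos hd (Real.sin_nonneg_of_mem_Icc hθ) hz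
  have h2 := overlap_nonneg (d := d) hz
  have h3 := lune_eq_sub_overlap d (u ^ (1 / (d : ℝ))) θ
  rw [rpow_one_div_pow (by omega) (pos_of_zMin_pow_lt hu).le] at h3
  rw [minusIntegrand, sub_nonneg]
  rcases (show lune d (u ^ (1 / (d : ℝ))) θ ≤ u by linarith).eq_or_lt with h | h
  · rw [h]
  · exact (F_lt_F h1 h).le

theorem minusIntegrand_pos (hd : 2 ≤ d) (hθ : θ ∈ Ioo 0 Real.pi) (hu : zMin θ ^ d < u) :
    0 < minusIntegrand d θ u := by
  have hz := zMin_lt_rpow (by omega) hu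
  have hs := Real.sin_pos_of_mem_Ioo hθ
  have h1 := lune_pos hd hs.le hz
  have h2 := overlap_pos (d := d) (by omega) hs hz
  have h3 := lune_eq_sub_overlap d (u ^ (1 / (d : ℝ))) θ
  rw [rpow_one_div_pow (by omega) (pos_of_zMin_pow_lt hu).le] at h3
  rw [minusIntegrand, sub_pos]
  exact F_lt_F h1 (by linarith)

theorem minusIntegrand_le (hd : 2 ≤ d) (hθ : θ ∈ Icc 0 Real.pi) (hu : zMin θ ^ d < u) :
    minusIntegrand d θ u ≤ 19 * Real.cos (θ / 2) ^ d * (1 + ‖u‖) ^ (-(3 / 2) : ℝ) := by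
  have hz := zMin_lt_rpow (by omega) hu
  have hu0 := pos_of_zMin_pow_lt hu
  have hs := Real.sin_nonneg_of_mem_Icc hθ
  have h1 := lune_pos hd hs hz
  have h2 := overlap_nonneg (d := d) hz
  have h3 := lune_eq_sub_overlap d (u ^ (1 / (d : ℝ))) θ
  have h4 := overlap_le_sqrt_mul (d := d) (by omega) hθ hz
  have h5 := overlap_le (d := d) (by omega) hs hz
  rw [rpow_one_div_pow (by omega) hu0.le] at h3 h4
  have hc : 0 ≤ Real.cos (θ / 2) := Real.cos_nonneg_of_mem_Icc
    ⟨by linarith [hθ.1, Real.pi_pos], by linarith [hθ.2]⟩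
  have h6 := F_sub_F_le h1 (y := u) (by linarith)
  set L := lune d (u ^ (1 / (d : ℝ))) θ
  -- The overlap is at most `3/2` and `L > 0`, so `1 + u ≤ 5/2 + L ≤ (5/2)(1 + L)`. The constant
  -- becomes `2 · (3/2) · (5/2)² = 75/4`, rounded up to `19`.
  have h7 : (1 + u) / (5 / 2) ≤ 1 + L := by
    rw [div_le_iff₀ (by norm_num)]
    linarith
  have h8 : √u ≤ (1 + u) ^ (1 / 2 : ℝ) := by
    rw [Real.sqrt_eq_rpow]
    exact Real.rpow_le_rpow hu0.le (by linarith) (by norm_num)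
  have h9 : (1 + u) ^ (1 / 2 : ℝ) / (1 + u) ^ 2 = (1 + u) ^ (-(3 / 2) : ℝ) := by
    rw [← Real.rpow_natCast (1 + u) 2, ← Real.rpow_sub (by linarith)]
    norm_num
  rw [Real.norm_of_nonneg hu0.le, ← h9]
  calc _ ≤ 2 * (u - L) / (1 + L) ^ 2 := h6
    _ ≤ 2 * (3 / 2 * (√u * Real.cos (θ / 2) ^ d)) / ((1 + u) / (5 / 2)) ^ 2 := by
        gcongr
        linarith
    _ = 75 / 4 * Real.cos (θ / 2) ^ d * (√u / (1 + u) ^ 2) := by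
        have : 1 + u ≠ 0 := by positivity
        field_simp
        ring
    _ ≤ _ := by
        gcongr
        norm_num

theorem measurable_minusIntegrand (hd : 1 ≤ d) :
    Measurable fun p : ℝ × ℝ => minusIntegrand d p.1 p.2 := by
  have h : Measurable fun p : ℝ × ℝ => lune d (p.2 ^ (1 / (d : ℝ))) p.1 :=
    (measurable_lune hd).comp (f := fun p : ℝ × ℝ => (p.2 ^ (1 / (d : ℝ)), p.1)) (by fun_prop)
  exact (measurable_F.comp h).sub (measurable_F.comp measurable_snd)

theorem integrable_decay : Integrable (fun u : ℝ => (1 + ‖u‖) ^ (-(3 / 2) : ℝ)) :=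
  integrable_one_add_norm (by norm_num)

theorem integrableOn_minusIntegrand (hd : 2 ≤ d) (hθ : θ ∈ Icc 0 Real.pi) :
    IntegrableOn (minusIntegrand d θ) (Ioi (zMin θ ^ d)) := by
  refine Integrable.mono'
    ((integrable_decay.const_mul (19 * Real.cos (θ / 2) ^ d)).integrableOn) ?_ ?_
  · exact ((measurable_minusIntegrand (by omega)).comp
      (measurable_const.prodMk measurable_id)).aestronglyMeasurable
  · refine (ae_restrict_iff' measurableSet_Ioi).2 (.of_forall fun u hu => ?_)
    rw [Real.norm_of_nonneg (minusIntegrand_nonneg hd hθ hu)]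
    exact minusIntegrand_le hd hθ hu

theorem integral_minusIntegrand_nonneg (hd : 2 ≤ d) (hθ : θ ∈ Icc 0 Real.pi) :
    0 ≤ ∫ u in Ioi (zMin θ ^ d), minusIntegrand d θ u :=
  setIntegral_nonneg measurableSet_Ioi fun _ hu => minusIntegrand_nonneg hd hθ hu

theorem integral_minusIntegrand_pos (hd : 2 ≤ d) (hθ : θ ∈ Ioo 0 Real.pi) :
    0 < ∫ u in Ioi (zMin θ ^ d), minusIntegrand d θ u := by
  have hθ' := Ioo_subset_Icc_self hθ
  rw [setIntegral_pos_iff_support_of_nonneg_ae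
    ((ae_restrict_iff' measurableSet_Ioi).2 (.of_forall fun u hu => minusIntegrand_nonneg hd hθ' hu))
    (integrableOn_minusIntegrand hd hθ')]
  have h : Function.support (minusIntegrand d θ) ∩ Ioi (zMin θ ^ d) = Ioi (zMin θ ^ d) :=
    inter_eq_right.2 fun u hu => (minusIntegrand_pos hd hθ hu).ne'
  rw [h, Real.volume_Ioi]
  exact ENNReal.zero_lt_top

theorem integral_minusIntegrand_le (hd : 2 ≤ d) (hθ : θ ∈ Icc 0 Real.pi) :
    ∫ u in Ioi (zMin θ ^ d), minusIntegrand d θ u ≤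
      19 * (∫ u : ℝ, (1 + ‖u‖) ^ (-(3 / 2) : ℝ)) * Real.cos (θ / 2) ^ d := by
  have hc : 0 ≤ Real.cos (θ / 2) := Real.cos_nonneg_of_mem_Icc
    ⟨by linarith [hθ.1, Real.pi_pos], by linarith [hθ.2]⟩
  have hi := integrable_decay.const_mul (19 * Real.cos (θ / 2) ^ d)
  calc _ ≤ ∫ u in Ioi (zMin θ ^ d), 19 * Real.cos (θ / 2) ^ d * (1 + ‖u‖) ^ (-(3 / 2) : ℝ) :=
        setIntegral_mono_on (integrableOn_minusIntegrand hd hθ) hi.integrableOn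
          measurableSet_Ioi fun u hu => minusIntegrand_le hd hθ hu
    _ ≤ ∫ u : ℝ, 19 * Real.cos (θ / 2) ^ d * (1 + ‖u‖) ^ (-(3 / 2) : ℝ) :=
        setIntegral_le_integral hi (.of_forall fun u => by positivity)
    _ = _ := by rw [integral_const_mul]; ring

/-- The integrand of the inner integral of `S d` in the variable `u = z ^ d`. -/
noncomputable def sibIntegrandPow (d : ℕ) (θ u : ℝ) : ℝ := F (lune d (u ^ (1 / (d : ℝ))) θ)

theorem sibIntegrandPow_eq : sibIntegrandPow d θ = minusIntegrand d θ + F := by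
  ext u
  simp [sibIntegrandPow, minusIntegrand]

theorem integrableOn_sibIntegrandPow (hd : 2 ≤ d) (hθ : θ ∈ Icc 0 Real.pi) :
    IntegrableOn (sibIntegrandPow d θ) (Ioi (zMin θ ^ d)) := by
  rw [sibIntegrandPow_eq]
  exact (integrableOn_minusIntegrand hd hθ).add (integrableOn_F (pow_nonneg (zMin_nonneg θ) d))

theorem integral_sibIntegrandPow (hd : 2 ≤ d) (hθ : θ ∈ Icc 0 Real.pi) :
    ∫ u in Ioi (zMin θ ^ d), sibIntegrandPow d θ u =
      logRatio (zMin θ ^ d) + ∫ u in Ioi (zMin θ ^ d), minusIntegrand d θ u := by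
  have h0 := pow_nonneg (zMin_nonneg θ) d
  rw [sibIntegrandPow_eq, ← integral_F h0, add_comm, ← integral_add (integrableOn_F h0)
    (integrableOn_minusIntegrand hd hθ)]
  rfl

theorem sibIntegrandPow_comp (hd : 1 ≤ d) {z : ℝ} (hz : 0 < z) :
    z ^ ((d : ℝ) - 1) • sibIntegrandPow d θ (z ^ (d : ℝ)) = sibIntegrand d θ z := by
  have hd' : (d : ℝ) ≠ 0 := by positivity
  rw [sibIntegrandPow, sibIntegrand, ← Real.rpow_mul hz.le, mul_one_div_cancel hd', Real.rpow_one,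
    smul_eq_mul]
  congr 1
  rw [← Real.rpow_natCast, Nat.cast_sub hd, Nat.cast_one]

theorem integrableOn_sibIntegrand (hd : 2 ≤ d) (hθ : θ ∈ Icc 0 Real.pi) :
    IntegrableOn (sibIntegrand d θ) (Ioi (zMin θ)) := by
  have hd' : (d : ℝ) ≠ 0 := by positivity
  -- The power substitution for integrability is applied on the whole half-line, hence the extension
  -- by zero below `zMin θ ^ d`.
  have h := (integrable_indicator_iff measurableSet_Ioi).2 (integrableOn_sibIntegrandPow hd hθ)
  have h2 := ((integrableOn_Ioi_comp_rpow_iff' _ hd').2 h.integrableOn).mono_set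
    (Ioi_subset_Ioi (zMin_nonneg θ))
  refine h2.congr_fun (fun z hz => ?_) measurableSet_Ioi
  have hz' : zMin θ ^ d < z ^ (d : ℝ) := by
    rw [Real.rpow_natCast]
    exact pow_lt_pow_left₀ hz (zMin_nonneg θ) (by omega)
  simp only
  rw [indicator_of_mem (by exact hz'), sibIntegrandPow_comp (by omega)
    ((zMin_nonneg θ).trans_lt hz)]

theorem integral_sibIntegrand (hd : 2 ≤ d) (hθ : θ ∈ Icc 0 Real.pi) :
    ∫ z in Ioi (zMin θ), sibIntegrand d θ z = 1 / d * (logRatio (zMin θ ^ d) +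
      ∫ u in Ioi (zMin θ ^ d), minusIntegrand d θ u) := by
  have hd' : (0 : ℝ) < d := by positivity
  rw [← integral_sibIntegrandPow hd hθ, ← integral_comp_rpow_Ioi_of_pos' hd'
    (pow_nonneg (zMin_nonneg θ) d), Real.pow_rpow_inv_natCast (zMin_nonneg θ) (by omega),
    ← integral_const_mul]
  refine setIntegral_congr_fun measurableSet_Ioi fun z hz => ?_
  rw [mul_smul, sibIntegrandPow_comp (by omega) ((zMin_nonneg θ).trans_lt hz), smul_eq_mul]
  field_simp

end Inner

/-! ### Angular integrals and the decomposition of `S`. -/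

section Outer

variable {d : ℕ}

theorem measurable_integral_minusIntegrand (hd : 1 ≤ d) :
    Measurable fun θ => ∫ u in Ioi (zMin θ ^ d), minusIntegrand d θ u := by
  have hm : MeasurableSet {p : ℝ × ℝ | zMin p.1 ^ d < p.2} :=
    measurableSet_lt ((continuous_zMin.measurable.comp measurable_fst).pow_const d) measurable_snd
  have h := ((measurable_minusIntegrand hd).indicator hm).stronglyMeasurable.integral_prod_right'
    (ν := volume)
  convert! h.measurable using 2 with θ
  -- The domain of integration depends on `θ`; as an indicator on the product it becomes a
  -- measurable integrand over a fixed domain.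
  rw [← integral_indicator measurableSet_Ioi]
  rfl

theorem intervalIntegrable_sin_pow_mul {g : ℝ → ℝ} {C : ℝ} (hm : Measurable g)
    (hg : ∀ θ ∈ Icc 0 Real.pi, |g θ| ≤ C) :
    IntervalIntegrable (fun θ => Real.sin θ ^ (d - 2) * g θ) volume 0 Real.pi := by
  rw [intervalIntegrable_iff_integrableOn_Icc_of_le Real.pi_pos.le]
  refine Integrable.mono' (integrableOn_const (C := C) (by simp)) ?_ ?_
  · exact ((Real.measurable_sin.pow_const _).mul hm).aestronglyMeasurable
  · refine (ae_restrict_iff' measurableSet_Icc).2 (.of_forall fun θ hθ => ?_)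
    rw [norm_mul, norm_pow, Real.norm_eq_abs, Real.norm_eq_abs]
    have h1 : |Real.sin θ| ^ (d - 2) ≤ 1 := pow_le_one₀ (abs_nonneg _) (Real.abs_sin_le_one θ)
    calc _ ≤ 1 * |g θ| := by gcongr
      _ ≤ C := by rw [one_mul]; exact hg θ hθ

theorem abs_integral_minusIntegrand_le (hd : 2 ≤ d) :
    ∀ θ ∈ Icc 0 Real.pi, |∫ u in Ioi (zMin θ ^ d), minusIntegrand d θ u| ≤
      19 * (∫ u : ℝ, (1 + ‖u‖) ^ (-(3 / 2) : ℝ)) := by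
  intro θ hθ
  have hc : 0 ≤ Real.cos (θ / 2) := Real.cos_nonneg_of_mem_Icc
    ⟨by linarith [hθ.1, Real.pi_pos], by linarith [hθ.2]⟩
  rw [abs_of_nonneg (integral_minusIntegrand_nonneg hd hθ)]
  refine (integral_minusIntegrand_le hd hθ).trans ?_
  have h1 : 0 ≤ ∫ u : ℝ, (1 + ‖u‖) ^ (-(3 / 2) : ℝ) := integral_nonneg fun u => by positivity
  exact mul_le_of_le_one_right (by positivity) (pow_le_one₀ hc (Real.cos_le_one _))

theorem intervalIntegrable_minusOuter (hd : 2 ≤ d) :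
    IntervalIntegrable (minusOuter d) volume 0 Real.pi :=
  intervalIntegrable_sin_pow_mul (measurable_integral_minusIntegrand (by omega))
    (abs_integral_minusIntegrand_le hd)

theorem measurable_logRatio_zMin : Measurable fun θ => logRatio (zMin θ ^ d) :=
  measurable_logRatio.comp (continuous_zMin.measurable.pow_const d)

theorem intervalIntegrable_logRatio :
    IntervalIntegrable (fun θ => Real.sin θ ^ (d - 2) * logRatio (zMin θ ^ d))
      volume 0 Real.pi := by
  refine intervalIntegrable_sin_pow_mul (C := 1) measurable_logRatio_zMin fun θ _ => ?_
  have h0 := pow_nonneg (zMin_nonneg θ) d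
  rw [abs_of_nonneg (logRatio_nonneg h0)]
  exact logRatio_le_one h0

theorem sibOuter_eq (hd : 2 ≤ d) {θ : ℝ} (hθ : θ ∈ Icc 0 Real.pi) :
    sibOuter d θ = 1 / d * (Real.sin θ ^ (d - 2) * logRatio (zMin θ ^ d) + minusOuter d θ) := by
  rw [sibOuter, minusOuter, integral_sibIntegrand hd hθ]
  ring

theorem intervalIntegrable_sibOuter (hd : 2 ≤ d) :
    IntervalIntegrable (sibOuter d) volume 0 Real.pi := by
  refine (((intervalIntegrable_logRatio (d := d)).add (intervalIntegrable_minusOuter hd)).const_mul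
    (1 / (d : ℝ))).congr fun θ hθ => ?_
  rw [uIoc_of_le Real.pi_pos.le] at hθ
  exact (sibOuter_eq hd (Ioc_subset_Icc_self hθ)).symm

theorem TMinus_pos (hd : 2 ≤ d) : 0 < TMinus d := by
  refine mul_pos (mul_pos two_pos (angConst_pos hd)) ?_
  refine intervalIntegral.intervalIntegral_pos_of_pos_on (intervalIntegrable_minusOuter hd)
    (fun θ hθ => ?_) Real.pi_pos
  exact mul_pos (pow_pos (Real.sin_pos_of_mem_Ioo hθ) _) (integral_minusIntegrand_pos hd hθ)

theorem cos_image_Ioo : Real.cos '' Ioo 0 (Real.pi / 2) = Ioo 0 1 := by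
  ext y
  constructor
  · rintro ⟨θ, ⟨h0, h1⟩, rfl⟩
    refine ⟨Real.cos_pos_of_mem_Ioo ⟨by linarith, h1⟩, ?_⟩
    rw [← Real.cos_zero]
    exact Real.cos_lt_cos_of_nonneg_of_le_pi_div_two le_rfl h1.le h0
  · rintro ⟨h0, h1⟩
    refine ⟨Real.arccos y, ⟨Real.arccos_pos.2 h1, Real.arccos_lt_pi_div_two.2 h0⟩, ?_⟩
    exact Real.cos_arccos (by linarith) h1.le

theorem injOn_cos_Ioo : InjOn Real.cos (Ioo 0 (Real.pi / 2)) :=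
  Real.injOn_cos.mono (Ioo_subset_Icc_self.trans
    (Icc_subset_Icc_right (by linarith [Real.pi_pos])))

theorem sin_mul_plusIntegrand (hd : 2 ≤ d) {θ : ℝ} (hθ : θ ∈ Ioo 0 (Real.pi / 2)) :
    |-Real.sin θ| • plusIntegrand d (Real.cos θ) =
      Real.sin θ ^ (d - 2) * (1 - logRatio (zMin θ ^ d)) := by
  have hs : 0 < Real.sin θ := Real.sin_pos_of_mem_Ioo ⟨hθ.1, by linarith [hθ.2, Real.pi_pos]⟩
  have hc : 0 < Real.cos θ := Real.cos_pos_of_mem_Ioo ⟨by linarith [hθ.1, Real.pi_pos], hθ.2⟩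
  have hz : zMin θ = 2 * Real.cos θ := max_eq_left (by positivity)
  rw [plusIntegrand, abs_neg, abs_of_pos hs, ← Real.sin_sq, hz, logRatio_of_pos (by positivity),
    mul_pow, smul_eq_mul, ← mul_assoc]
  congr 1
  rw [← Real.rpow_natCast, ← Real.rpow_mul hs.le, ← Real.rpow_natCast, Nat.cast_sub hd]
  nth_rewrite 1 [← Real.rpow_one (Real.sin θ)]
  rw [← Real.rpow_add hs]
  congr 1
  push_cast
  ring

theorem intervalIntegrable_one_sub_logRatio :
    IntervalIntegrable (fun θ => Real.sin θ ^ (d - 2) * (1 - logRatio (zMin θ ^ d)))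
      volume 0 Real.pi := by
  refine intervalIntegrable_sin_pow_mul (C := 1) (measurable_logRatio_zMin.const_sub 1)
    fun θ _ => ?_
  have h0 := pow_nonneg (zMin_nonneg θ) d
  rw [abs_le]
  constructor <;> linarith [logRatio_nonneg h0, logRatio_le_one h0]

/-- For `d = 2` the exponent `(d-3)/2` is negative and the integrand is singular at `z = 1`; under
`z = cos θ` the Jacobian removes the singularity. -/
theorem intervalIntegrable_plusIntegrand (hd : 2 ≤ d) :
    IntervalIntegrable (plusIntegrand d) volume 0 1 := by
  rw [intervalIntegrable_iff_integrableOn_Ioo_of_le zero_le_one, ← cos_image_Ioo,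
    integrableOn_image_iff_integrableOn_abs_deriv_smul measurableSet_Ioo
      (fun θ _ => (Real.hasDerivAt_cos θ).hasDerivWithinAt)
      injOn_cos_Ioo]
  have h := (intervalIntegrable_iff_integrableOn_Ioo_of_le Real.pi_pos.le).1
    (intervalIntegrable_one_sub_logRatio (d := d))
  refine (h.mono_set (Ioo_subset_Ioo_right (by linarith [Real.pi_pos]))).congr_fun
    (fun θ hθ => ?_) measurableSet_Ioo
  exact (sin_mul_plusIntegrand hd hθ).symm

theorem integral_plusIntegrand (hd : 2 ≤ d) :
    ∫ z in (0 : ℝ)..1, plusIntegrand d z =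
      ∫ θ in (0 : ℝ)..Real.pi, Real.sin θ ^ (d - 2) * (1 - logRatio (zMin θ ^ d)) := by
  have hi := intervalIntegrable_one_sub_logRatio (d := d)
  have hpi := Real.pi_pos
  have hi1 := hi.mono_set (c := 0) (d := Real.pi / 2) (by
    rw [uIcc_of_le (by linarith), uIcc_of_le hpi.le]; exact Icc_subset_Icc_right (by linarith))
  have hi2 := hi.mono_set (c := Real.pi / 2) (d := Real.pi) (by
    rw [uIcc_of_le (by linarith), uIcc_of_le hpi.le]; exact Icc_subset_Icc_left (by linarith))
  rw [← intervalIntegral.integral_add_adjacent_intervals hi1 hi2]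
  -- Obtuse angles contribute nothing: there `zMin θ = 0` and the defect `1 - logRatio 0` vanishes.
  have h2 : ∫ θ in (Real.pi / 2)..Real.pi,
      Real.sin θ ^ (d - 2) * (1 - logRatio (zMin θ ^ d)) = 0 := by
    refine intervalIntegral.integral_zero_ae (.of_forall fun θ hθ => ?_)
    rw [uIoc_of_le (by linarith)] at hθ
    have hc : Real.cos θ ≤ 0 := Real.cos_nonpos_of_pi_div_two_le_of_le hθ.1.le (by linarith [hθ.2])
    have hz : zMin θ = 0 := max_eq_right (by linarith)
    rw [hz, zero_pow (by omega), logRatio_zero]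
    simp
  rw [h2, add_zero, intervalIntegral.integral_of_le zero_le_one,
    intervalIntegral.integral_of_le (by linarith), integral_Ioc_eq_integral_Ioo,
    integral_Ioc_eq_integral_Ioo, ← cos_image_Ioo,
    integral_image_eq_integral_abs_deriv_smul measurableSet_Ioo
      (fun θ _ => (Real.hasDerivAt_cos θ).hasDerivWithinAt)
      injOn_cos_Ioo]
  exact setIntegral_congr_fun measurableSet_Ioo fun θ hθ => sin_mul_plusIntegrand hd hθ

theorem TPlus_pos (hd : 2 ≤ d) : 0 < TPlus d := by
  refine mul_pos (mul_pos two_pos (angConst_pos hd)) ?_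
  refine intervalIntegral.intervalIntegral_pos_of_pos_on (intervalIntegrable_plusIntegrand hd)
    (fun z hz => ?_) zero_lt_one
  obtain ⟨h0, h1⟩ := hz
  have h2 := logRatio_lt_one (x := 2 ^ d * z ^ d) (by positivity)
  rw [logRatio_of_pos (by positivity)] at h2
  exact mul_pos (Real.rpow_pos_of_pos (by nlinarith) _) (by linarith)

theorem S_eq (hd : 2 ≤ d) : S d = 2 - TPlus d + TMinus d := by
  have hd' : (0 : ℝ) < d := by positivity
  have hV := V_pos d
  have e1 : ((d : ℝ) - 1) * V (d - 1) / V d = d * angConst d := by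
    rw [angConst]; field_simp
  have e2 : ∫ θ in (0 : ℝ)..Real.pi, sibOuter d θ = 1 / d *
      ((∫ θ in (0 : ℝ)..Real.pi, Real.sin θ ^ (d - 2) * logRatio (zMin θ ^ d)) +
        ∫ θ in (0 : ℝ)..Real.pi, minusOuter d θ) := by
    rw [← intervalIntegral.integral_add intervalIntegrable_logRatio
      (intervalIntegrable_minusOuter hd), ← intervalIntegral.integral_const_mul]
    refine intervalIntegral.integral_congr fun θ hθ => ?_
    rw [uIcc_of_le Real.pi_pos.le] at hθ
    exact sibOuter_eq hd hθ
  have e3 : ∫ θ in (0 : ℝ)..Real.pi, Real.sin θ ^ (d - 2) * logRatio (zMin θ ^ d) =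
      (∫ θ in (0 : ℝ)..Real.pi, Real.sin θ ^ (d - 2)) - ∫ z in (0 : ℝ)..1, plusIntegrand d z := by
    rw [integral_plusIntegrand hd, eq_sub_iff_add_eq, ← intervalIntegral.integral_add
      intervalIntegrable_logRatio intervalIntegrable_one_sub_logRatio]
    congr 1
    ext θ
    ring
  have e4 := angConst_mul_integral hd
  rw [S, TPlus, TMinus, e1, e2, e3, ← angConst]
  field_simp
  linear_combination e4

end Outer

/-! ### Exponential bound for `TMinus`. -/

/-- The maximum over `s ≥ 0` is `M = 4√3/9`, at `r = √3/3`, and the gap is exactly `2(s + 2r)(s -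
r)²`. Keeping only `4r(s - r)² = 3M(s - r)²` leaves `M(1 - 3(s - r)²)`, below the Gaussian. The
Gaussian factor saves the `1/√d` needed to absorb `angConst d`. -/
theorem two_mul_mul_one_sub_sq_le {s : ℝ} (hs : 0 ≤ s) :
    2 * s * (1 - s ^ 2) ≤ 4 * √3 / 9 * Real.exp (-3 * (s - √3 / 3) ^ 2) := by
  have h3 : √3 ^ 2 = (3 : ℝ) := Real.sq_sqrt (by norm_num)
  have h0 : 0 < √3 := by positivity
  have h1 : -3 * (s - √3 / 3) ^ 2 + 1 ≤ Real.exp (-3 * (s - √3 / 3) ^ 2) := Real.add_one_le_exp _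
  have h2 : 4 * √3 / 9 * (-3 * (s - √3 / 3) ^ 2 + 1) - 2 * s * (1 - s ^ 2) =
      2 * s * (s - √3 / 3) ^ 2 := by
    generalize √3 = r at *
    linear_combination (2 / 3 * s - 4 / 27 * r) * h3
  have h4 : 0 ≤ 2 * s * (s - √3 / 3) ^ 2 := by positivity
  calc _ ≤ 4 * √3 / 9 * (-3 * (s - √3 / 3) ^ 2 + 1) := by linarith
    _ ≤ _ := by gcongr

theorem integral_pow_le_gaussian (n : ℕ) (hn : 0 < n) :
    ∫ s in (0 : ℝ)..1, (2 * s * (1 - s ^ 2)) ^ n ≤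
      (4 * √3 / 9) ^ n * √(Real.pi / (3 * n)) := by
  have hn' : (0 : ℝ) < n := by exact_mod_cast hn
  have hi : Integrable fun s : ℝ => Real.exp (-(3 * n) * (s - √3 / 3) ^ 2) :=
    (integrable_exp_neg_mul_sq (b := 3 * n) (by positivity)).comp_sub_right (√3 / 3)
  have hg : ∫ s : ℝ, Real.exp (-(3 * n) * (s - √3 / 3) ^ 2) = √(Real.pi / (3 * n)) := by
    rw [integral_sub_right_eq_self (fun s : ℝ => Real.exp (-(3 * n) * s ^ 2)), integral_gaussian]
  rw [← hg, ← integral_const_mul]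
  have hi' := hi.const_mul ((4 * √3 / 9) ^ n)
  refine le_trans ?_ (setIntegral_le_integral (s := Ioc 0 1) hi' (.of_forall fun s => by positivity))
  rw [← intervalIntegral.integral_of_le zero_le_one]
  refine intervalIntegral.integral_mono_on zero_le_one
    (Continuous.intervalIntegrable (by fun_prop) _ _) hi'.intervalIntegrable fun s hs => ?_
  have h0 : 0 ≤ 1 - s ^ 2 := by nlinarith [hs.1, hs.2]
  have h1 := pow_le_pow_left₀ (mul_nonneg (mul_nonneg zero_le_two hs.1) h0)
    (two_mul_mul_one_sub_sq_le hs.1) n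
  rw [mul_pow (4 * √3 / 9), ← Real.exp_nat_mul] at h1
  refine h1.trans (le_of_eq ?_)
  congr 2
  ring

theorem integral_sin_pow_mul_cos_half_pow_le {d : ℕ} (hd : 3 ≤ d) :
    ∫ θ in (0 : ℝ)..Real.pi, Real.sin θ ^ (d - 2) * Real.cos (θ / 2) ^ d ≤
      2 * ((4 * √3 / 9) ^ (d - 2) * √(Real.pi / (3 * (d - 2 : ℕ)))) := by
  have hsub := intervalIntegral.integral_comp_mul_deriv (a := 0) (b := Real.pi)
    (f := fun θ => Real.sin (θ / 2)) (f' := fun θ => Real.cos (θ / 2) * (1 / 2))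
    (g := fun s => (2 * s * (1 - s ^ 2)) ^ (d - 2))
    (fun θ _ => ((hasDerivAt_id θ).div_const 2).sin) (by fun_prop) (by fun_prop)
  simp only [zero_div, Real.sin_zero, Real.sin_pi_div_two] at hsub
  have h := integral_pow_le_gaussian (d - 2) (by omega)
  rw [← hsub] at h
  refine le_trans ?_ (mul_le_mul_of_nonneg_left h zero_le_two)
  rw [← intervalIntegral.integral_const_mul]
  refine intervalIntegral.integral_mono_on Real.pi_pos.le
    (Continuous.intervalIntegrable (by fun_prop) _ _)
    (Continuous.intervalIntegrable (by fun_prop) _ _) fun θ hθ => ?_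
  have hc : 0 ≤ Real.cos (θ / 2) := Real.cos_nonneg_of_mem_Icc
    ⟨by linarith [hθ.1, Real.pi_pos], by linarith [hθ.2]⟩
  have hs : 0 ≤ Real.sin (θ / 2) := Real.sin_nonneg_of_mem_Icc
    ⟨by linarith [hθ.1], by linarith [hθ.2, Real.pi_pos]⟩
  have e1 : Real.sin θ = 2 * Real.sin (θ / 2) * Real.cos (θ / 2) := by
    rw [← Real.sin_two_mul]; congr 1; ring
  have e2 : 1 - Real.sin (θ / 2) ^ 2 = Real.cos (θ / 2) ^ 2 := by rw [Real.cos_sq']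
  obtain ⟨n, rfl⟩ := Nat.exists_eq_add_of_le' (show 2 ≤ d by omega)
  simp only [Function.comp_apply, e2, e1, Nat.add_sub_cancel]
  -- Of the two spare cosines one is bounded by `1`; the other is the Jacobian of `s = sin(θ/2)`, up
  -- to the factor `2`.
  calc _ = (2 * Real.sin (θ / 2) * Real.cos (θ / 2) ^ 2) ^ n *
        (Real.cos (θ / 2) * Real.cos (θ / 2)) := by ring
    _ ≤ (2 * Real.sin (θ / 2) * Real.cos (θ / 2) ^ 2) ^ n * (Real.cos (θ / 2) * 1) := by
        gcongr; exact Real.cos_le_one _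
    _ = _ := by ring

theorem TMinus_le {d : ℕ} (hd : 3 ≤ d) :
    TMinus d ≤ 76 * (∫ u : ℝ, (1 + ‖u‖) ^ (-(3 / 2) : ℝ)) * angConst d *
      ((4 * √3 / 9) ^ (d - 2) * √(Real.pi / (3 * (d - 2 : ℕ)))) := by
  set K := ∫ u : ℝ, (1 + ‖u‖) ^ (-(3 / 2) : ℝ) with hK
  have hK0 : 0 ≤ K := integral_nonneg fun u => by positivity
  have hc := angConst_pos (d := d) (by omega)
  have h1 : ∫ θ in (0 : ℝ)..Real.pi, minusOuter d θ ≤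
      ∫ θ in (0 : ℝ)..Real.pi, 19 * K * (Real.sin θ ^ (d - 2) * Real.cos (θ / 2) ^ d) := by
    refine intervalIntegral.integral_mono_on Real.pi_pos.le
      (intervalIntegrable_minusOuter (by omega))
      (Continuous.intervalIntegrable (by fun_prop) _ _) fun θ hθ => ?_
    have hs := Real.sin_nonneg_of_mem_Icc hθ
    have h2 := integral_minusIntegrand_le (d := d) (by omega) hθ
    calc _ ≤ Real.sin θ ^ (d - 2) * (19 * K * Real.cos (θ / 2) ^ d) := by
          unfold minusOuter; gcongr
      _ = _ := by ring
  rw [intervalIntegral.integral_const_mul] at h1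
  have h3 := integral_sin_pow_mul_cos_half_pow_le hd
  calc TMinus d = 2 * angConst d * ∫ θ in (0 : ℝ)..Real.pi, minusOuter d θ := rfl
    _ ≤ 2 * angConst d * (19 * K *
        (2 * ((4 * √3 / 9) ^ (d - 2) * √(Real.pi / (3 * (d - 2 : ℕ)))))) := by
        gcongr
        exact h1.trans (by gcongr)
    _ = _ := by ring

theorem TMinus_isBigO : TMinus =O[atTop] (fun d : ℕ => (4 * √3 / 9) ^ d) := by
  set K := ∫ u : ℝ, (1 + ‖u‖) ^ (-(3 / 2) : ℝ) with hK
  have hK0 : 0 ≤ K := integral_nonneg fun u => by positivity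
  set M : ℝ := 4 * √3 / 9 with hM
  have hM0 : 0 < M := by positivity
  obtain ⟨C, hC⟩ := tendsto_angConst_div_sqrt.isBoundedUnder_le
  rw [eventually_map] at hC
  refine IsBigO.of_bound (76 * K * C * √Real.pi / M ^ 2) ?_
  filter_upwards [hC, eventually_ge_atTop 3] with d hdC hd
  have hd' : (0 : ℝ) < d := by positivity
  have hd2 : (0 : ℝ) < (d - 2 : ℕ) := by
    have : 0 < d - 2 := by omega
    exact_mod_cast this
  have hc := angConst_pos (d := d) (by omega)
  have hcC : angConst d ≤ C * √(d : ℝ) := (div_le_iff₀ (by positivity)).1 hdC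
  have hC0 : 0 ≤ C := (div_pos hc (by positivity)).le.trans hdC
  have h1 : √(d : ℝ) * √(Real.pi / (3 * (d - 2 : ℕ))) ≤ √Real.pi := by
    rw [← Real.sqrt_mul hd'.le]
    refine Real.sqrt_le_sqrt ?_
    rw [← mul_div_assoc, div_le_iff₀ (by positivity), mul_comm]
    gcongr
    rw [Nat.cast_sub (by omega)]
    have : (3 : ℝ) ≤ d := by exact_mod_cast hd
    push_cast
    linarith
  have h2 : M ^ d = M ^ (d - 2) * M ^ 2 := by rw [← pow_add]; congr 1; omega
  rw [Real.norm_of_nonneg (TMinus_pos (by omega)).le, Real.norm_of_nonneg (by positivity)]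
  calc _ ≤ 76 * K * angConst d * (M ^ (d - 2) * √(Real.pi / (3 * (d - 2 : ℕ)))) := TMinus_le hd
    _ ≤ 76 * K * (C * √(d : ℝ)) * (M ^ (d - 2) * √(Real.pi / (3 * (d - 2 : ℕ)))) := by gcongr
    _ = 76 * K * C * M ^ (d - 2) * (√(d : ℝ) * √(Real.pi / (3 * (d - 2 : ℕ)))) := by ring
    _ ≤ 76 * K * C * M ^ (d - 2) * √Real.pi := by gcongr
    _ = _ := by rw [h2]; field_simp

/-! ### The limit integral `∫ x^(-4/3) (1 - logRatio x)`. -/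

/-- An antiderivative of `t / (1 + t ^ 3)`. -/
noncomputable def primCube (t : ℝ) : ℝ :=
  1 / 6 * Real.log ((t ^ 2 - t + 1) / (1 + t) ^ 2) + 1 / √3 * Real.arctan ((2 * t - 1) / √3)

theorem hasDerivAt_primCube {t : ℝ} (ht : 0 ≤ t) :
    HasDerivAt primCube (t / (1 + t ^ 3)) t := by
  have h3 : √3 ^ 2 = (3 : ℝ) := Real.sq_sqrt (by norm_num)
  have h0 : 0 < √3 := by positivity
  have hp : 0 < t ^ 2 - t + 1 := by nlinarith [sq_nonneg (t - 1 / 2)]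
  have hq : 0 < 1 + t := by positivity
  have hid := hasDerivAt_id' t
  have h1 : HasDerivAt (fun t : ℝ => t ^ 2 - t + 1) (2 * t - 1) t := by
    simpa using ((hid.pow 2).sub hid).add_const 1
  have h2 : HasDerivAt (fun t : ℝ => (1 + t) ^ 2) (2 * (1 + t)) t := by
    simpa using (hid.const_add 1).fun_pow 2
  have h4 : HasDerivAt (fun t : ℝ => (2 * t - 1) / √3) (2 / √3) t := by
    simpa using ((hid.const_mul 2).sub_const 1).div_const √3
  have h5 := (((h1.div h2 (by positivity)).log (by
    simp only [Pi.div_apply]; positivity)).const_mul (1 / 6)).add (h4.arctan.const_mul (1 / √3))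
  refine h5.congr_deriv ?_
  have e1 : 1 + ((2 * t - 1) / √3) ^ 2 = 4 / 3 * (t ^ 2 - t + 1) := by
    rw [div_pow, h3]; ring
  have e2 : 1 + t ^ 3 = (1 + t) * (t ^ 2 - t + 1) := by ring
  have e3 : 1 / √3 * (1 / (4 / 3 * (t ^ 2 - t + 1)) * (2 / √3)) =
      1 / (2 * (t ^ 2 - t + 1)) := by
    have : 1 / √3 * (1 / (4 / 3 * (t ^ 2 - t + 1)) * (2 / √3)) =
      (2 * (1 / (4 / 3 * (t ^ 2 - t + 1)))) / √3 ^ 2 := by ring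
    rw [this, h3]
    field_simp
    ring
  simp only [Pi.div_apply]
  rw [e1, e2, e3]
  field_simp
  ring

theorem tendsto_inv_one_add_atTop : Tendsto (fun t : ℝ => (1 + t)⁻¹) atTop (nhds 0) :=
  tendsto_inv_atTop_zero.comp (tendsto_atTop_add_const_left _ 1 tendsto_id)

theorem tendsto_primCube_atTop :
    Tendsto primCube atTop (nhds (1 / √3 * (Real.pi / 2))) := by
  have h1 : Tendsto (fun t : ℝ => (t ^ 2 - t + 1) / (1 + t) ^ 2) atTop (nhds 1) := by
    have h := ((tendsto_inv_one_add_atTop.const_mul 3).const_sub 1).add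
      ((tendsto_inv_one_add_atTop.pow 2).const_mul 3)
    norm_num at h
    refine h.congr' ?_
    filter_upwards [eventually_gt_atTop 0] with t ht
    have : 1 + t ≠ 0 := by positivity
    field_simp
    ring
  have h2 : Tendsto (fun t : ℝ => (2 * t - 1) / √3) atTop atTop := by
    refine Tendsto.atTop_div_const (by positivity) ?_
    exact tendsto_atTop_add_const_right _ (-1) (tendsto_id.const_mul_atTop two_pos)
  have h3 := (Real.tendsto_arctan_atTop.mono_right nhdsWithin_le_nhds).comp h2
  have h4 := ((h1.log one_ne_zero).const_mul (1 / 6)).add (h3.const_mul (1 / √3))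
  rwa [Real.log_one, mul_zero, zero_add] at h4

theorem primCube_zero : primCube 0 = -(1 / √3 * (Real.pi / 6)) := by
  have h : (2 * 0 - 1) / √3 = -(√3)⁻¹ := by ring
  rw [primCube, h, Real.arctan_neg, Real.arctan_inv_sqrt_three]
  norm_num

/-- An antiderivative of `3 (t ^ 3 - log (1 + t ^ 3)) / t ^ 5`. -/
noncomputable def primDefect (t : ℝ) : ℝ :=
  -(3 / 4 * ((t ^ 3 - Real.log (1 + t ^ 3)) / t ^ 4)) + 9 / 4 * primCube t

theorem primDefect_def (t : ℝ) : primDefect t =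
    -(3 / 4 * ((t ^ 3 - Real.log (1 + t ^ 3)) / t ^ 4)) + 9 / 4 * primCube t := rfl

theorem log_one_add_cube_le {t : ℝ} (ht : 0 < t) : Real.log (1 + t ^ 3) ≤ t ^ 3 := by
  have := Real.log_le_sub_one_of_pos (x := 1 + t ^ 3) (by positivity)
  linarith

theorem cube_sub_log_le {t : ℝ} (ht : 0 < t) : t ^ 3 - Real.log (1 + t ^ 3) ≤ t ^ 6 := by
  have h3 : 0 < t ^ 3 := by positivity
  have h := one_sub_logRatio_le h3
  rw [logRatio_of_pos h3, sub_le_iff_le_add, ← sub_le_iff_le_add', le_div_iff₀ h3] at h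
  linarith [h, show (1 - t ^ 3) * t ^ 3 = t ^ 3 - t ^ 6 by ring]

theorem hasDerivAt_primDefect {t : ℝ} (ht : 0 < t) :
    HasDerivAt primDefect (3 * ((t ^ 3 - Real.log (1 + t ^ 3)) / t ^ 5)) t := by
  have hid := hasDerivAt_id' t
  have h1 : HasDerivAt (fun t : ℝ => t ^ 3) (3 * t ^ 2) t := by simpa using hid.fun_pow 3
  have h2 : HasDerivAt (fun t : ℝ => t ^ 4) (4 * t ^ 3) t := by simpa using hid.fun_pow 4
  have h3 := ((((h1.sub ((h1.const_add 1).log (by positivity))).div h2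
    (by positivity)).const_mul (3 / 4)).neg).add ((hasDerivAt_primCube ht.le).const_mul (9 / 4))
  refine h3.congr_deriv ?_
  have : 1 + t ^ 3 ≠ 0 := by positivity
  simp only [Pi.sub_apply]
  field_simp
  ring

/-- The quotient at `0` is `0` by the convention on division, which agrees with its limit because
the numerator is at most `t^6`. -/
theorem primDefect_zero : primDefect 0 = 9 / 4 * primCube 0 := by
  simp [primDefect]

theorem continuousWithinAt_primDefect : ContinuousWithinAt primDefect (Ici 0) 0 := by
  rw [← continuousWithinAt_Ioi_iff_Ici, ContinuousWithinAt, primDefect_zero]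
  have h1 : Tendsto (fun t : ℝ => (t ^ 3 - Real.log (1 + t ^ 3)) / t ^ 4)
      (nhdsWithin 0 (Ioi 0)) (nhds 0) := by
    have h2 : Tendsto (fun t : ℝ => t ^ 2) (nhdsWithin 0 (Ioi 0)) (nhds 0) := by
      have h : ContinuousAt (fun t : ℝ => t ^ 2) 0 := by fun_prop
      simpa [ContinuousAt] using h.mono_left (nhdsWithin_le_nhds (s := Ioi 0))
    refine tendsto_of_tendsto_of_tendsto_of_le_of_le' tendsto_const_nhds h2 ?_ ?_
    · filter_upwards [self_mem_nhdsWithin] with t ht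
      have ht : 0 < t := ht
      exact div_nonneg (sub_nonneg.2 (log_one_add_cube_le ht)) (by positivity)
    · filter_upwards [self_mem_nhdsWithin] with t ht
      have ht : 0 < t := ht
      rw [div_le_iff₀ (by positivity)]
      exact (cube_sub_log_le ht).trans (le_of_eq (by ring))
  have h2 := (hasDerivAt_primCube le_rfl).continuousAt.tendsto.mono_left
    (nhdsWithin_le_nhds (s := Ioi 0))
  simpa [funext primDefect_def] using ((h1.const_mul (3 / 4)).neg).add (h2.const_mul (9 / 4))

theorem tendsto_primDefect_atTop :
    Tendsto primDefect atTop (nhds (9 / 4 * (1 / √3 * (Real.pi / 2)))) := by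
  have h1 : Tendsto (fun t : ℝ => (t ^ 3 - Real.log (1 + t ^ 3)) / t ^ 4) atTop (nhds 0) := by
    refine tendsto_of_tendsto_of_tendsto_of_le_of_le' tendsto_const_nhds
      tendsto_inv_atTop_zero ?_ ?_
    · filter_upwards [eventually_gt_atTop 0] with t ht
      exact div_nonneg (sub_nonneg.2 (log_one_add_cube_le ht)) (by positivity)
    · filter_upwards [eventually_gt_atTop 0] with t ht
      have : 0 ≤ Real.log (1 + t ^ 3) :=
        Real.log_nonneg (le_add_of_nonneg_right (by positivity))
      rw [div_le_iff₀ (by positivity)]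
      have e : t⁻¹ * t ^ 4 = t ^ 3 := by field_simp
      rw [e]
      linarith
  simpa [funext primDefect_def] using ((h1.const_mul (3 / 4)).neg).add (tendsto_primCube_atTop.const_mul (9 / 4))

/-- The substitution `x = t³` clears the fractional power. The boundary quotients vanish at both
ends, leaving `(9/4)(1/√3)(π/2 + π/6)`. -/
theorem integral_rpow_mul_one_sub_logRatio :
    ∫ x in Ioi (0 : ℝ), x ^ (-(4 / 3) : ℝ) * (1 - logRatio x) = Real.pi * √3 / 2 := by
  rw [← integral_comp_rpow_Ioi_of_pos (p := 3) (by norm_num)]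
  have h : ∫ t in Ioi (0 : ℝ), 3 * ((t ^ 3 - Real.log (1 + t ^ 3)) / t ^ 5) =
      9 / 4 * (1 / √3 * (Real.pi / 2)) - primDefect 0 :=
    integral_Ioi_of_hasDerivAt_of_nonneg continuousWithinAt_primDefect
      (fun t ht => hasDerivAt_primDefect ht)
      (fun t (ht : 0 < t) => mul_nonneg (by norm_num)
        (div_nonneg (sub_nonneg.2 (log_one_add_cube_le ht)) (by positivity)))
      tendsto_primDefect_atTop
  have h3 : √3 ^ 2 = (3 : ℝ) := Real.sq_sqrt (by norm_num)
  have h0 : 0 < √3 := by positivity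
  have e : 9 / 4 * (1 / √3 * (Real.pi / 2)) - primDefect 0 = Real.pi * √3 / 2 := by
    rw [primDefect_zero, primCube_zero]
    field_simp
    rw [h3]
    ring
  rw [← e, ← h]
  refine setIntegral_congr_fun measurableSet_Ioi fun t (ht : 0 < t) => ?_
  simp only [smul_eq_mul]
  have e1 : t ^ ((3 : ℝ) - 1) = t ^ 2 := by rw [← Real.rpow_natCast]; norm_num
  have e2 : t ^ (3 : ℝ) = t ^ 3 := by rw [← Real.rpow_natCast]; norm_num
  have e3 : (t ^ 3) ^ (-(4 / 3) : ℝ) = (t ^ 4)⁻¹ := by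
    rw [← Real.rpow_natCast, ← Real.rpow_natCast, ← Real.rpow_mul ht.le, ← Real.rpow_neg ht.le]
    norm_num
  rw [e1, e2, e3, logRatio_of_pos (by positivity)]
  field_simp

/-! ### Asymptotics of `TPlus` by rescaling and dominated convergence. -/

/-- The integrand of `T₊` in the variable `x = (2 z) ^ d`, normalised by its value at `z = 1 / 2`. -/
noncomputable def plusRescaled (d : ℕ) (x : ℝ) : ℝ :=
  if x ^ (1 / (d : ℝ)) < 2 then
    ((4 - (x ^ (1 / (d : ℝ))) ^ 2) / 3) ^ (((d : ℝ) - 3) / 2) * x ^ (1 / (d : ℝ) - 1) *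
      (1 - logRatio x) else 0

theorem integral_plusIntegrand_eq_rescaled {d : ℕ} (hd : 1 ≤ d) :
    ∫ z in (0 : ℝ)..1, plusIntegrand d z =
      1 / (2 * d) * (3 / 4) ^ (((d : ℝ) - 3) / 2) * ∫ x in Ioi (0 : ℝ), plusRescaled d x := by
  have hd' : (0 : ℝ) < d := by exact_mod_cast hd
  have h1 : ∫ z in (0 : ℝ)..1, plusIntegrand d z =
      ∫ z in Ioi (0 : ℝ), (Iio 1).indicator (plusIntegrand d) z := by
    rw [setIntegral_indicator measurableSet_Iio, Ioi_inter_Iio,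
      intervalIntegral.integral_of_le zero_le_one, integral_Ioc_eq_integral_Ioo]
  have h2 := integral_comp_mul_left_Ioi ((Iio 1).indicator (plusIntegrand d)) 0
    (b := (2 : ℝ)⁻¹) (by norm_num)
  rw [mul_zero, inv_inv, ← h1, ← integral_comp_rpow_Ioi_of_pos (p := 1 / (d : ℝ)) (by positivity),
    smul_eq_mul] at h2
  rw [mul_assoc, ← integral_const_mul]
  have h3 : ∫ x in Ioi (0 : ℝ), (1 / (d : ℝ) * x ^ (1 / (d : ℝ) - 1)) •
      (Iio 1).indicator (plusIntegrand d) (2⁻¹ * x ^ (1 / (d : ℝ))) =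
      1 / d * ∫ x in Ioi (0 : ℝ), (3 / 4) ^ (((d : ℝ) - 3) / 2) * plusRescaled d x := by
    rw [← integral_const_mul]
    refine setIntegral_congr_fun measurableSet_Ioi fun x (hx : 0 < x) => ?_
    simp only [smul_eq_mul, plusRescaled, indicator, mem_Iio]
    set y := x ^ (1 / (d : ℝ)) with hy
    have hy0 : 0 < y := by positivity
    have hyx : y ^ d = x := rpow_one_div_pow hd hx.le
    by_cases hy2 : y < 2
    · rw [if_pos hy2, if_pos (by linarith)]
      have e1 : 1 - (2⁻¹ * y) ^ 2 = 3 / 4 * ((4 - y ^ 2) / 3) := by ring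
      have e2 : (2 : ℝ) ^ d * (2⁻¹ * y) ^ d = x := by
        rw [← mul_pow, ← hyx]; congr 1; ring
      rw [plusIntegrand, e1, e2, Real.mul_rpow (by norm_num) (by nlinarith), logRatio_of_pos hx]
      ring
    · rw [if_neg hy2, if_neg (by linarith)]
      simp
  rw [h3] at h2
  field_simp
  field_simp at h2
  linarith

theorem plusRescaled_nonneg (d : ℕ) {x : ℝ} (hx : 0 < x) : 0 ≤ plusRescaled d x := by
  unfold plusRescaled
  split_ifs with h
  · have h0 : 0 < x ^ (1 / (d : ℝ)) := by positivity
    have h1 : 0 ≤ (4 - (x ^ (1 / (d : ℝ))) ^ 2) / 3 := div_nonneg (by nlinarith) (by norm_num)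
    have h2 := logRatio_le_one hx.le
    exact mul_nonneg (mul_nonneg (Real.rpow_nonneg h1 _) (by positivity)) (by linarith)
  · exact le_rfl

/-- With `w = (2/d) log x`, the base is `(4 - e^w)/3 ≤ 1 - w/3 ≤ e^(-w/3)`, so the powers combine to
at most `x^(-4/3 + 2/d)`. For `d ≥ 8` this exponent lies in `[-4/3, -13/12]`, and the sum of the two
extreme powers covers both `x ≤ 1` and `x ≥ 1`. The end `-13/12 < -1` secures integrability at
infinity. -/
theorem plusRescaled_le {d : ℕ} (hd : 8 ≤ d) {x : ℝ} (hx : 0 < x) :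
    plusRescaled d x ≤ (x ^ (-(4 / 3) : ℝ) + x ^ (-(13 / 12) : ℝ)) * (1 - logRatio x) := by
  have hd8 : (8 : ℝ) ≤ d := by exact_mod_cast hd
  have hlr := logRatio_le_one hx.le
  unfold plusRescaled
  split_ifs with h
  · refine mul_le_mul_of_nonneg_right ?_ (by linarith)
    have h0 : 0 < x ^ (1 / (d : ℝ)) := by positivity
    have h1 : 0 ≤ (4 - (x ^ (1 / (d : ℝ))) ^ 2) / 3 := div_nonneg (by nlinarith) (by norm_num)
    have h2 : (x ^ (1 / (d : ℝ))) ^ 2 = Real.exp (2 / d * Real.log x) := by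
      rw [Real.rpow_def_of_pos hx, ← Real.exp_nat_mul]
      congr 1
      push_cast
      ring
    have h3 : (4 - (x ^ (1 / (d : ℝ))) ^ 2) / 3 ≤ x ^ (-(2 / (3 * d)) : ℝ) := by
      have h4 := Real.add_one_le_exp (2 / d * Real.log x)
      have h5 := Real.add_one_le_exp (Real.log x * (-(2 / (3 * d))))
      have e : Real.log x * (-(2 / (3 * d))) = -(2 / d * Real.log x) / 3 := by
        field_simp
      rw [h2, Real.rpow_def_of_pos hx]
      rw [e] at h5 ⊢
      linarith
    have h4 : ((4 - (x ^ (1 / (d : ℝ))) ^ 2) / 3) ^ (((d : ℝ) - 3) / 2) * x ^ (1 / (d : ℝ) - 1) ≤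
        x ^ (-(4 / 3) + 2 / d : ℝ) := by
      calc _ ≤ (x ^ (-(2 / (3 * d)) : ℝ)) ^ (((d : ℝ) - 3) / 2) * x ^ (1 / (d : ℝ) - 1) := by
            gcongr
            linarith
        _ = _ := by
            rw [← Real.rpow_mul hx.le, ← Real.rpow_add hx]
            congr 1
            field_simp
            ring
    refine h4.trans ?_
    have h5 : (2 : ℝ) / d ≤ 1 / 4 := by
      rw [div_le_iff₀ (by linarith)]; linarith
    have h6 : 0 ≤ (2 : ℝ) / d := by positivity
    rcases le_total x 1 with hx1 | hx1
    · have := Real.rpow_le_rpow_of_exponent_ge hx hx1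
        (show -(4 / 3) ≤ (-(4 / 3) + 2 / d : ℝ) by linarith)
      have : 0 ≤ x ^ (-(13 / 12) : ℝ) := by positivity
      linarith
    · have := Real.rpow_le_rpow_of_exponent_le hx1
        (show (-(4 / 3) + 2 / d : ℝ) ≤ -(13 / 12) by linarith)
      have : 0 ≤ x ^ (-(4 / 3) : ℝ) := by positivity
      linarith
  · have : 0 ≤ x ^ (-(4 / 3) : ℝ) + x ^ (-(13 / 12) : ℝ) := by positivity
    exact mul_nonneg this (by linarith)

theorem integrableOn_plusRescaled_bound :
    IntegrableOn (fun x : ℝ => (x ^ (-(4 / 3) : ℝ) + x ^ (-(13 / 12) : ℝ)) * (1 - logRatio x))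
      (Ioi 0) := by
  have hm : Measurable fun x : ℝ =>
      (x ^ (-(4 / 3) : ℝ) + x ^ (-(13 / 12) : ℝ)) * (1 - logRatio x) := by fun_prop
  rw [← Ioc_union_Ioi_eq_Ioi zero_le_one]
  refine IntegrableOn.union ?_ ?_
  · have hi : IntegrableOn (fun x : ℝ => 2 * x ^ (-(1 / 3) : ℝ)) (Ioc 0 1) := by
      have := intervalIntegral.intervalIntegrable_rpow' (a := 0) (b := 1) (r := -(1 / 3)) (by norm_num)
      rw [intervalIntegrable_iff_integrableOn_Ioc_of_le zero_le_one] at this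
      exact this.const_mul 2
    refine Integrable.mono' hi hm.aestronglyMeasurable ?_
    refine (ae_restrict_iff' measurableSet_Ioc).2 (.of_forall fun x ⟨hx0, hx1⟩ => ?_)
    have h1 := logRatio_le_one hx0.le
    have h2 := one_sub_logRatio_le hx0
    rw [Real.norm_of_nonneg (mul_nonneg (by positivity) (by linarith))]
    have h3 := Real.rpow_le_rpow_of_exponent_ge hx0 hx1
      (show (-(4 / 3) : ℝ) ≤ -(13 / 12) by norm_num)
    calc _ ≤ (x ^ (-(4 / 3) : ℝ) + x ^ (-(4 / 3) : ℝ)) * x ^ (1 : ℝ) := by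
          rw [Real.rpow_one]; gcongr
      _ = 2 * (x ^ (-(4 / 3) : ℝ) * x ^ (1 : ℝ)) := by ring
      _ = _ := by rw [← Real.rpow_add hx0]; norm_num
  · have hi : IntegrableOn (fun x : ℝ => 2 * x ^ (-(13 / 12) : ℝ)) (Ioi 1) :=
      (integrableOn_Ioi_rpow_of_lt (by norm_num) one_pos).const_mul 2
    refine Integrable.mono' hi hm.aestronglyMeasurable ?_
    refine (ae_restrict_iff' measurableSet_Ioi).2 (.of_forall fun x (hx : 1 < x) => ?_)
    have hx0 : 0 < x := by linarith
    have h1 := logRatio_le_one hx0.le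
    have h2 := logRatio_nonneg hx0.le
    rw [Real.norm_of_nonneg (mul_nonneg (by positivity) (by linarith))]
    have h3 := Real.rpow_le_rpow_of_exponent_le hx.le
      (show (-(4 / 3) : ℝ) ≤ -(13 / 12) by norm_num)
    calc _ ≤ (x ^ (-(13 / 12) : ℝ) + x ^ (-(13 / 12) : ℝ)) * 1 := by
          gcongr; linarith
      _ = _ := by ring

theorem tendsto_plusRescaled {x : ℝ} (hx : 0 < x) :
    Tendsto (fun d : ℕ => plusRescaled d x) atTop
      (nhds (x ^ (-(4 / 3) : ℝ) * (1 - logRatio x))) := by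
  have hinv : Tendsto (fun d : ℕ => 1 / (d : ℝ)) atTop (nhds 0) :=
    tendsto_one_div_atTop_nhds_zero_nat
  -- The exponent `((d-3)/2) q(1/d)` tends to `q'(0)/2 = -(1/3) log x`, as `q(0) = 0`; together with
  -- `x^(1/d - 1) → x^(-1)` this gives `x^(-4/3)`.
  set q : ℝ → ℝ := fun h => Real.log ((4 - (x ^ h) ^ 2) / 3) with hq
  have hq0 : q 0 = 0 := by
    rw [hq]; norm_num
  have hder : HasDerivAt q (-(2 / 3) * Real.log x) 0 := by
    have h1 : HasDerivAt (fun h : ℝ => x ^ h) (x ^ (0 : ℝ) * Real.log x) 0 :=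
      (Real.hasStrictDerivAt_const_rpow hx 0).hasDerivAt
    have h2 := (((h1.pow 2).const_sub 4).div_const 3).log (by norm_num)
    refine h2.congr_deriv ?_
    norm_num
    ring
  have hyinv : Tendsto (fun d : ℕ => x ^ (1 / (d : ℝ))) atTop (nhds 1) := by
    have := (Real.continuous_const_rpow hx.ne').tendsto 0
    rw [Real.rpow_zero] at this
    exact this.comp hinv
  have hslope : Tendsto (fun d : ℕ => (d : ℝ) * q (1 / d)) atTop
      (nhds (-(2 / 3) * Real.log x)) := by
    have h1 : Tendsto (fun d : ℕ => 1 / (d : ℝ)) atTop (nhdsWithin 0 {0}ᶜ) := by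
      refine tendsto_nhdsWithin_iff.2 ⟨hinv, ?_⟩
      filter_upwards [eventually_ge_atTop 1] with d hd
      have : (0 : ℝ) < d := by exact_mod_cast hd
      simpa using this.ne'
    refine ((hasDerivAt_iff_tendsto_slope.1 hder).comp h1).congr fun d => ?_
    simp [slope_def_field, hq0, mul_comm]
  have hqlim : Tendsto (fun d : ℕ => q (1 / d)) atTop (nhds 0) := by
    have := hder.continuousAt.tendsto
    rw [hq0] at this
    exact this.comp hinv
  have hexp := ((hslope.const_mul (1 / 2)).sub (hqlim.const_mul (3 / 2))).rexp
  have hpow : Tendsto (fun d : ℕ => x ^ (1 / (d : ℝ) - 1)) atTop (nhds (x ^ (0 - 1 : ℝ))) :=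
    ((Real.continuous_const_rpow hx.ne').tendsto (0 - 1)).comp (hinv.sub_const 1)
  have hall := (hexp.mul hpow).mul_const (1 - logRatio x)
  have e : Real.exp (1 / 2 * (-(2 / 3) * Real.log x) - 3 / 2 * 0) * x ^ (0 - 1 : ℝ) =
      x ^ (-(4 / 3) : ℝ) := by
    have e1 : 1 / 2 * (-(2 / 3) * Real.log x) - 3 / 2 * 0 = Real.log x * (-(1 / 3)) := by ring
    rw [e1, ← Real.rpow_def_of_pos hx, ← Real.rpow_add hx]
    norm_num
  rw [e] at hall
  refine hall.congr' ?_
  filter_upwards [hyinv.eventually_lt_const (show (1 : ℝ) < 2 by norm_num)] with d hd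
  have h0 : 0 < x ^ (1 / (d : ℝ)) := by positivity
  have h1 : 0 < (4 - (x ^ (1 / (d : ℝ))) ^ 2) / 3 := div_pos (by nlinarith) (by norm_num)
  rw [plusRescaled, if_pos hd, Real.rpow_def_of_pos h1]
  congr 3
  rw [hq]
  ring

theorem measurable_plusRescaled (d : ℕ) : Measurable (plusRescaled d) := by
  unfold plusRescaled
  exact Measurable.ite (measurableSet_lt (by fun_prop) measurable_const) (by fun_prop)
    measurable_const

theorem tendsto_integral_plusRescaled :
    Tendsto (fun d : ℕ => ∫ x in Ioi (0 : ℝ), plusRescaled d x) atTop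
      (nhds (Real.pi * √3 / 2)) := by
  rw [← integral_rpow_mul_one_sub_logRatio]
  refine tendsto_integral_filter_of_dominated_convergence _
    (.of_forall fun d => (measurable_plusRescaled d).aestronglyMeasurable) ?_
    integrableOn_plusRescaled_bound ?_
  · filter_upwards [eventually_ge_atTop 8] with d hd
    refine (ae_restrict_iff' measurableSet_Ioi).2 (.of_forall fun x hx => ?_)
    rw [Real.norm_of_nonneg (plusRescaled_nonneg d hx)]
    exact plusRescaled_le hd hx
  · exact (ae_restrict_iff' measurableSet_Ioi).2 (.of_forall fun x hx => tendsto_plusRescaled hx)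

theorem three_quarters_rpow (d : ℕ) :
    (3 / 4 : ℝ) ^ (((d : ℝ) - 3) / 2) = 8 * √3 / 9 * (√3 / 2) ^ d := by
  have h3 : √3 ^ 2 = (3 : ℝ) := Real.sq_sqrt (by norm_num)
  have h0 : 0 < √3 := by positivity
  have e1 : (3 / 4 : ℝ) = (√3 / 2) ^ (2 : ℝ) := by
    rw [Real.rpow_two, div_pow, h3]; norm_num
  have e2 : 2 * (((d : ℝ) - 3) / 2) = d - (3 : ℕ) := by push_cast; ring
  rw [e1, ← Real.rpow_mul (by positivity), e2, Real.rpow_sub (by positivity), Real.rpow_natCast,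
    Real.rpow_natCast]
  field_simp
  rw [show √3 ^ 4 = (√3 ^ 2) ^ 2 by ring, h3]
  norm_num

theorem TPlus_isEquivalent :
    TPlus ~[atTop] (fun d : ℕ => 2 * √(2 * Real.pi) / 3 * (1 / √(d : ℝ)) * (√3 / 2) ^ d) := by
  have hpi := Real.pi_pos
  refine (isEquivalent_iff_tendsto_one ?_).2 ?_
  · filter_upwards [eventually_ge_atTop 1] with d hd
    have : (0 : ℝ) < d := by exact_mod_cast hd
    positivity
  have h := (tendsto_angConst_div_sqrt.mul tendsto_integral_plusRescaled).const_mul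
    (4 * √3 / (3 * √(2 * Real.pi)))
  have e : 4 * √3 / (3 * √(2 * Real.pi)) * (1 / √(2 * Real.pi) * (Real.pi * √3 / 2)) = 1 := by
    have h3 : √3 ^ 2 = (3 : ℝ) := Real.sq_sqrt (by norm_num)
    have h2 : √(2 * Real.pi) ^ 2 = 2 * Real.pi := Real.sq_sqrt (by positivity)
    have h0 : 0 < √(2 * Real.pi) := by positivity
    field_simp
    rw [h3, h2]
    ring
  rw [e] at h
  refine h.congr' ?_
  filter_upwards [eventually_ge_atTop 1] with d hd
  have hd' : (0 : ℝ) < d := by exact_mod_cast hd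
  have hs : √(d : ℝ) ^ 2 = d := Real.sq_sqrt hd'.le
  rw [Pi.div_apply, TPlus, integral_plusIntegrand_eq_rescaled hd, three_quarters_rpow, ← angConst]
  have h0 : 0 < √(2 * Real.pi) := by positivity
  have h1 : (0 : ℝ) < (√3 / 2) ^ d := by positivity
  have hsd : 0 < √(d : ℝ) := by positivity
  generalize ∫ x in Ioi (0 : ℝ), plusRescaled d x = J
  generalize (√3 / 2) ^ d = P at *
  generalize √(d : ℝ) = r at *
  rw [← hs]
  field_simp
  ring

/-! ### Comparison of the two terms and conclusion. -/

theorem TMinus_isLittleO_TPlus : TMinus =o[atTop] TPlus := by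
  have h3 : 0 < √3 := by positivity
  have h33 : √3 ^ 2 = (3 : ℝ) := Real.sq_sqrt (by norm_num)
  refine (TMinus_isBigO.trans_isLittleO ?_).trans_isBigO TPlus_isEquivalent.symm.isBigO
  refine isLittleO_of_tendsto' ?_ ?_
  · filter_upwards [eventually_ge_atTop 1] with d hd h
    have : (0 : ℝ) < d := by exact_mod_cast hd
    have : 0 < 2 * √(2 * Real.pi) / 3 * (1 / √(d : ℝ)) * (√3 / 2) ^ d := by positivity
    exact absurd h this.ne'
  have h1 : Tendsto (fun d : ℕ => (d : ℝ) * (8 / 9) ^ d) atTop (nhds 0) :=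
    tendsto_self_mul_const_pow_of_lt_one (by norm_num) (by norm_num)
  have h2 := h1.const_mul (3 / (2 * √(2 * Real.pi)))
  rw [mul_zero] at h2
  refine squeeze_zero' (.of_forall fun d => by positivity) ?_ h2
  filter_upwards [eventually_ge_atTop 1] with d hd
  have hd1 : (1 : ℝ) ≤ d := by exact_mod_cast hd
  have e1 : (4 * √3 / 9) ^ d = (8 / 9) ^ d * (√3 / 2) ^ d := by
    rw [← mul_pow]; congr 1; ring
  have h4 : √(d : ℝ) ≤ d := by
    rw [Real.sqrt_le_left (by linarith)]
    nlinarith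
  calc _ = 3 / (2 * √(2 * Real.pi)) * (√(d : ℝ) * (8 / 9) ^ d) := by
        rw [e1]
        field_simp
    _ ≤ _ := by gcongr

theorem two_sub_S_isEquivalent : (fun d : ℕ => 2 - S d) ~[atTop] TPlus := by
  have h : (TPlus - TMinus) ~[atTop] TPlus :=
    IsEquivalent.refl.sub_isLittleO TMinus_isLittleO_TPlus
  refine h.congr_left ?_
  filter_upwards [eventually_ge_atTop 2] with d hd
  rw [S_eq hd, Pi.sub_apply]
  ring

theorem tendsto_asymptotic_zero :
    Tendsto (fun d : ℕ => 2 * √(2 * Real.pi) / 3 * (1 / √(d : ℝ)) * (√3 / 2) ^ d)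
      atTop (nhds 0) := by
  have h1 : Tendsto (fun d : ℕ => (√3 / 2) ^ d) atTop (nhds 0) := by
    refine tendsto_pow_atTop_nhds_zero_of_lt_one (by positivity) ?_
    rw [div_lt_one two_pos, Real.sqrt_lt' two_pos]
    norm_num
  have h2 : Tendsto (fun d : ℕ => 1 / √(d : ℝ)) atTop (nhds 0) := by
    simp only [one_div]
    exact tendsto_inv_atTop_zero.comp (Real.tendsto_sqrt_atTop.comp tendsto_natCast_atTop_atTop)
  simpa using (h2.const_mul (2 * √(2 * Real.pi) / 3)).mul h1

end NNTree

theorem theorem3 :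
    -- for `d ≥ 2`, all the integrals converge, and `T_+(d)`, `T_-(d)` are positive
    (∀ d : ℕ, 2 ≤ d →
      (IntervalIntegrable (NNTree.plusIntegrand d) volume 0 1 ∧
        (∀ θ ∈ Icc 0 Real.pi,
          IntegrableOn (NNTree.minusIntegrand d θ) (Ioi (NNTree.zMin θ ^ d)) volume ∧
          IntegrableOn (NNTree.sibIntegrand d θ) (Ioi (NNTree.zMin θ)) volume) ∧
        IntervalIntegrable (NNTree.minusOuter d) volume 0 Real.pi ∧
        IntervalIntegrable (NNTree.sibOuter d) volume 0 Real.pi) ∧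
      0 < NNTree.TPlus d ∧ 0 < NNTree.TMinus d) ∧
    -- the asymptotic behaviour of `T_+` and `T_-`
    NNTree.TPlus ~[atTop]
      (fun d : ℕ => 2 * √(2 * Real.pi) / 3 * (1 / √(d : ℝ)) * (√3 / 2) ^ d) ∧
    NNTree.TMinus =O[atTop] (fun d : ℕ => (4 * √3 / 9) ^ d) ∧
    -- `S_d` tends to `2`, exponentially fast, at rate `√3 / 2`
    Tendsto NNTree.S atTop (nhds 2) ∧
    (fun d : ℕ => 2 - NNTree.S d) ~[atTop]
      (fun d : ℕ => 2 * √(2 * Real.pi) / 3 * (1 / √(d : ℝ)) * (√3 / 2) ^ d) := by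
  have hequiv := NNTree.two_sub_S_isEquivalent.trans NNTree.TPlus_isEquivalent
  refine ⟨fun d hd => ⟨⟨NNTree.intervalIntegrable_plusIntegrand hd,
    fun θ hθ => ⟨NNTree.integrableOn_minusIntegrand hd hθ, NNTree.integrableOn_sibIntegrand hd hθ⟩,
    NNTree.intervalIntegrable_minusOuter hd, NNTree.intervalIntegrable_sibOuter hd⟩,
    NNTree.TPlus_pos hd, NNTree.TMinus_pos hd⟩,
    NNTree.TPlus_isEquivalent, NNTree.TMinus_isBigO, ?_, hequiv⟩
  have h := (hequiv.symm.tendsto_nhds NNTree.tendsto_asymptotic_zero).const_sub 2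
  simpa using h
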